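/- Write $u_k=\partial_x^k u$. Let $\Omega$ be a nonempty connected open set of jets $(t,x,u,u_1,\dots,u_6)\in\mathbb R^9$ on which $u_1\neq 0$, let $I$ be the open interval of values of $u$ on $\Omega$, and let $f:I\to\mathbb R$ be smooth and not identically zero. Consider the gKN equation $$u_t=K_3:=u_{3}-\frac32\frac{u_{2}^2}{u_1}+\frac{f(u)}{u_1}.$$ A smooth function $P(t,x,u,u_1,\dots,u_6)$ on $\Omega$ is (the characteristic of) a symmetry $P\partial_u$ of this equation if $$D_tP-D_x^3P+3\frac{u_2}{u_1}D_x^2P-\frac32\frac{u_2^2}{u_1^2}D_xP+\frac{f(u)}{u_1^2}D_xP-\frac{f'(u)}{u_1}P=0$$ holds identically in $t,x,u,u_1,u_2,\dots$ (with $(t,x,u,\dots,u_6)\in\Omega$), where $D_x=\partial_x+\sum_k u_{k+1}\partial_{u_k}$ and, $t$-derivatives being eliminated through the equation, $D_t=\partial_t+\sum_k D_x^k(K_3)\,\partial_{u_k}$. It has order $n$ if $P$ depends on $u_n$ but on no $u_k$ with $k>n$. Put $$\begin{aligned}K_5={}&u_5-5\frac{u_4u_2}{u_1}-\frac52\frac{u_3^2}{u_1}+\frac{25}{2}\frac{u_3u_2^2}{u_1^2}-\frac{45}{8}\frac{u_2^4}{u_1^3}-\frac53\frac{u_3f(u)}{u_1^2}+\frac{25}{6}\frac{u_2^2f(u)}{u_1^3}\\&-\frac53\frac{u_2f'(u)}{u_1}-\frac5{18}\frac{f(u)^2}{u_1^3}+\frac59u_1f''(u),\end{aligned}$$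 and, for $b\in\mathbb R$ and a real polynomial $q(u)$ of degree at most two, $$S_{b,q}=3bt\,K_3+bx\,u_1+q(u)$$ (the characteristic of the point transformation generator $-3bt\,\partial_t-bx\,\partial_x+q(u)\,\partial_u$); call $(b,q)$ admissible if $2f(q'+2b)=f'q$ on $I$. Then: (i) There is no symmetry of order $2$, $4$ or $6$, and in order $1$ there are only point symmetries: $P$ is a symmetry of order one if and only if $P=a\,u_1+q(u)$ with a constant $a\ne0$ and $(0,q)$ admissible. (ii) For every $f$, $K_3\,\partial_u=u_t\,\partial_u$ is a symmetry of order three, and it is the only one up to a constant factor and point symmetries: $P$ is a symmetry of order three if and only if $P=a_1K_3+a_2u_1+S_{b,q}$ with constants $a_1,a_2,b$, $(a_1,b)\neq(0,0)$, and $(b,q)$ admissible. (iii) If $f$ is a polynomial of degree at most four on $I$, then $K_5\,\partial_u$ is a symmetry of order five. There is a symmetry of order five only for such $f$, and it is unique up to a constant factor and point symmetries: $P$ is a symmetry of order five if and only if $f$ is a polynomial of degree at most four on $I$ and $P=cK_5+a_1K_3+a_2u_1+S_{b,q}$ with constants $c\neq0$, $a_1,a_2,b$, and $(b,q)$ admissible.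 (iv) In particular, a symmetry $P(t,x,u,u_1,\dots,u_6)$ can depend explicitly on $t$ or $x$ only through a dilational point symmetry: if it does, then there is an admissible $(b,q)$ with $b\neq0$ such that $S_{b,q}$ is a symmetry and $P-S_{b,q}$ does not depend explicitly on $t$ or $x$. -/

import Mathlib

open scoped ContDiff

noncomputable section

namespace GKN

/-- Jets of order at most `n` of a function `u(t,x)` in the `x`-direction:
points `(t, x, (u, u_x, u_xx, …))` with `u_k = ∂_x^k u` for `k ≤ n`. -/
abbrev Jet (n : ℕ) : Type := ℝ × ℝ × (Fin (n + 1) → ℝ)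

/-- Infinite jets `(t, x, (u_k)_k)`. -/
abbrev JetInf : Type := ℝ × ℝ × (ℕ → ℝ)

/-- Projection of an infinite jet to its part of order at most `n`. -/
def trunc (n : ℕ) (z : JetInf) : Jet n := (z.1, z.2.1, fun k => z.2.2 k)

/-- A function of finitely many jet variables, viewed as a function on infinite jets. -/
def lift {n : ℕ} (P : Jet n → ℝ) : JetInf → ℝ := fun z => P (trunc n z)

/-- Partial derivative `∂G/∂t` (explicit `t`-dependence only). -/
def partialT (G : JetInf → ℝ) (z : JetInf) : ℝ := deriv (fun s => G (s, z.2.1, z.2.2)) z.1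

/-- Partial derivative `∂G/∂x` (explicit `x`-dependence only). -/
def partialX (G : JetInf → ℝ) (z : JetInf) : ℝ := deriv (fun s => G (z.1, s, z.2.2)) z.2.1

/-- Partial derivative `∂G/∂u_k`. -/
def partialU (k : ℕ) (G : JetInf → ℝ) (z : JetInf) : ℝ :=
  deriv (fun s => G (z.1, z.2.1, Function.update z.2.2 k s)) (z.2.2 k)

/-- Total `x`-derivative `D_x = ∂_x + ∑_k u_{k+1} ∂_{u_k}`. The sum has finite support on functions
of finitely many jet variables. -/
def totalX (G : JetInf → ℝ) (z : JetInf) : ℝ :=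
  partialX G z + ∑ᶠ k : ℕ, z.2.2 (k + 1) * partialU k G z

/-- `u_xxx - (3/2) u_xx² / u_x + f(u) / u_x`, the right-hand side of the equation,
that is, the characteristic `u_t` with `u_t` eliminated. -/
def flow3 (f : ℝ → ℝ) (z : Jet 6) : ℝ :=
  z.2.2 3 - 3 / 2 * (z.2.2 2 ^ 2 / z.2.2 1) + f (z.2.2 0) / z.2.2 1

/-- Total `t`-derivative on solutions of `u_t = flow3 f`:
`D_t = ∂_t + ∑_k D_x^k(flow3 f) ∂_{u_k}`, since `∂_t u_k = D_x^k u_t` on solutions. -/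
def totalT (f : ℝ → ℝ) (G : JetInf → ℝ) (z : JetInf) : ℝ :=
  partialT G z + ∑ᶠ k : ℕ, (totalX^[k] (lift (flow3 f))) z * partialU k G z

/-- The evolutionary vector field `P ∂_u`, with characteristic `P` defined on the set `Ω` of jets of
order at most six, is a symmetry of `u_t = u_xxx - (3/2) u_xx² / u_x + f(u) / u_x`: the
linearization of the equation vanishes on `P` on all solutions, that is, identically in the jet
variables `t, x, u, u_x, u_xx, …` once `t`-derivatives are eliminated through the equation. -/
def IsSymmetry (f : ℝ → ℝ) (Ω : Set (Jet 6)) (P : Jet 6 → ℝ) : Prop :=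
  ∀ z : JetInf, trunc 6 z ∈ Ω →
    totalT f (lift P) z - (totalX^[3] (lift P)) z
      + 3 * (z.2.2 2 / z.2.2 1) * (totalX^[2] (lift P)) z
      - 3 / 2 * (z.2.2 2 ^ 2 / z.2.2 1 ^ 2) * totalX (lift P) z
      + f (z.2.2 0) / z.2.2 1 ^ 2 * totalX (lift P) z
      - deriv f (z.2.2 0) / z.2.2 1 * lift P z = 0

/-- `P` has differential order exactly `n` on `Ω`: it does not involve `u_k` for `k > n`, and it
does involve `u_n`. -/
def HasOrder (Ω : Set (Jet 6)) (P : Jet 6 → ℝ) (n : ℕ) : Prop :=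
  (∀ k : ℕ, n < k → ∀ z : JetInf, trunc 6 z ∈ Ω → partialU k (lift P) z = 0) ∧
    ∃ z : JetInf, trunc 6 z ∈ Ω ∧ partialU n (lift P) z ≠ 0

/-- The interval of values of `u` on `Ω`. -/
def uRange (Ω : Set (Jet 6)) : Set ℝ := (fun z : Jet 6 => z.2.2 0) '' Ω

/-- The fifth-order Krichever–Novikov flow. -/
def flow5 (f : ℝ → ℝ) (z : Jet 6) : ℝ :=
  z.2.2 5 - 5 * (z.2.2 4 * z.2.2 2 / z.2.2 1) - 5 / 2 * (z.2.2 3 ^ 2 / z.2.2 1)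
    + 25 / 2 * (z.2.2 3 * z.2.2 2 ^ 2 / z.2.2 1 ^ 2) - 45 / 8 * (z.2.2 2 ^ 4 / z.2.2 1 ^ 3)
    - 5 / 3 * (z.2.2 3 * f (z.2.2 0) / z.2.2 1 ^ 2)
    + 25 / 6 * (z.2.2 2 ^ 2 * f (z.2.2 0) / z.2.2 1 ^ 3)
    - 5 / 3 * (z.2.2 2 * deriv f (z.2.2 0) / z.2.2 1)
    - 5 / 18 * (f (z.2.2 0) ^ 2 / z.2.2 1 ^ 3)
    + 5 / 9 * (z.2.2 1 * iteratedDeriv 2 f (z.2.2 0))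

/-- `f` is a polynomial of degree at most four on `I`. -/
def IsQuarticOn (f : ℝ → ℝ) (I : Set ℝ) : Prop :=
  ∃ C₁ C₂ C₃ C₄ C₅ : ℝ, ∀ u ∈ I, f u = C₁ * u ^ 4 + C₂ * u ^ 3 + C₃ * u ^ 2 + C₄ * u + C₅

/-- The condition `2 f (q' + 2 b) = f' q` on `I`, with `q(u) = q₂ u² + q₁ u + q₀`. -/
def DilationODE (f : ℝ → ℝ) (I : Set ℝ) (b q₀ q₁ q₂ : ℝ) : Prop :=
  ∀ u ∈ I, 2 * f u * (2 * q₂ * u + q₁ + 2 * b) = deriv f u * (q₂ * u ^ 2 + q₁ * u + q₀)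

/-- `(3 b t) u_t + (b x) u_x + q(u)`, with `q(u) = q₂ u² + q₁ u + q₀`: the characteristic of the
point transformation generator `-3 b t ∂_t - b x ∂_x + q(u) ∂_u`. -/
def dilation (f : ℝ → ℝ) (b q₀ q₁ q₂ : ℝ) (z : Jet 6) : ℝ :=
  3 * b * z.1 * flow3 f z + b * z.2.1 * z.2.2 1 + (q₂ * z.2.2 0 ^ 2 + q₁ * z.2.2 0 + q₀)

end GKN

end

/-! ### The abstract jet algebra and its vector fields. -/

noncomputable section

namespace GKN

/-! Write `P = u_1 R` and `s = 1/u_1`. Since `u_1` is itself a symmetry, the linearized equation for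
`P` becomes `L R = 0` with `L = D_t - D^3 - (3w - g0) D`, an operator without zeroth-order term.
Here `w` is the Schwarzian derivative of `u` and `g_j = f^(j)(u) u_1^(j-2)`; the equation reads `u_t
= u_1 H` with `H = w + g0`.

The engine is `pd_L`: if `R` has order at most `n ≥ 2`, then the `u_{n+2}`-derivative of `L R` is
`-3 s D(u_1 ∂R/∂u_n)`. So `L R = 0` forces `u_1 ∂R/∂u_n` to be killed by `D`, that is, to depend on
`t` alone. One subtracts that function of `t` times a model with the same leading term (`D^3 w`,
`R5`, `D w`, `H`, `a`) and descends to the next order. What obstructs is nonlinearity: the remainder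
has too low an order for its image under `L` to contain squares of high jets, while the models
produce such squares. This kills order six (`ordLE_five`), then order four, order two and the time
dependence of the coefficient of `R5` (`exists_ordLE_zero`).

What remains is `R = β R5 + δ H + (δ_t/3) x + ζ + q/u_1` with `q` a function of `t, x, u`. Now `L R`
is polynomial in `u_2/u_1`, and after `q_x = 0` is read off, `u_1^2 L R` is polynomial in `u_1`. Its
coefficients give `q_t = 0`, `q''' = 0`, the equation linking `q` and `f`, `δ_tt = ζ_t = 0` and `β
f^(5) = 0`, the last because `L R5 = (4/9) f^(5) u_1^3` (`L_R5`). This is `classification`; orders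
and explicit `t, x` dependence are then read off the general solution `sol`.

All of this uses only the axioms of `JetCalculus`. The analytic part, `calculus`, shows that smooth
functions of finitely many jets over `Ω` satisfy them; connectedness of `Ω` enters only in the axiom
on constants. -/

/-- The coordinates `t, x, u_0, u_1, …` of the infinite jet space. -/
inductive Coord : Type
  | t : Coord
  | x : Coord
  | u (k : ℕ) : Coord

/-- The algebraic structure carried by the smooth functions of finitely many jet variables: the
partial derivatives, the coordinates, the inverse of `u_1` and the derivatives of `f(u)`. -/
structure JetCalculus (A : Type*) [CommRing A] [Algebra ℝ A] where
  pd : Coord → Derivation ℝ A A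
  pd_comm : ∀ i j G, pd i (pd j G) = pd j (pd i G)
  pd_finite : ∀ G, {i | pd i G ≠ 0}.Finite
  coord : Coord → A
  pd_coord_self : ∀ i, pd i (coord i) = 1
  pd_coord_ne : ∀ i j, i ≠ j → pd i (coord j) = 0
  s : A
  u_one_mul_s : coord (.u 1) * s = 1
  F : ℕ → A
  pd_F : ∀ j, pd (.u 0) (F j) = F (j + 1)
  pd_F_ne : ∀ i j, i ≠ .u 0 → pd i (F j) = 0
  const : ∀ G, (∀ i, pd i G = 0) → ∃ c : ℝ, G = algebraMap ℝ A c

namespace JetCalculus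

variable {A : Type*} [CommRing A] [Algebra ℝ A] (J : JetCalculus A)

lemma support_finite (v : Coord → A) (G : A) :
    (Function.support fun i => v i * J.pd i G).Finite :=
  (J.pd_finite G).subset fun i hi h => hi (by simp [h])

/-- The vector field with the given components. -/
def field (v : Coord → A) : Derivation ℝ A A :=
  Derivation.mk'
    { toFun := fun G => ∑ᶠ i, v i * J.pd i G
      map_add' := fun G H => by
        rw [← finsum_add_distrib (J.support_finite v G) (J.support_finite v H)]
        simp [mul_add]
      map_smul' := fun c G => by
        rw [RingHom.id_apply, smul_finsum' c (J.support_finite v G)]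
        simp }
    fun G H => by
      simp only [LinearMap.coe_mk, AddHom.coe_mk, smul_eq_mul]
      rw [mul_finsum' _ G (J.support_finite v H), mul_finsum' _ H (J.support_finite v G),
        ← finsum_add_distrib]
      · refine finsum_congr fun i => ?_
        simp only [Derivation.leibniz, smul_eq_mul]
        ring
      · exact (J.support_finite v H).subset fun i hi h => hi (by simp [h])
      · exact (J.support_finite v G).subset fun i hi h => hi (by simp [h])

lemma field_apply (v : Coord → A) (G : A) : J.field v G = ∑ᶠ i, v i * J.pd i G := rfl

lemma field_eq_sum' {v : Coord → A} {G : A} {S : Finset Coord}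
    (h : ∀ i ∉ S, v i * J.pd i G = 0) : J.field v G = ∑ i ∈ S, v i * J.pd i G := by
  rw [field_apply]
  refine finsum_eq_sum_of_support_subset _ fun i hi => ?_
  by_contra hS
  exact hi (h i hS)

lemma field_eq_sum (v : Coord → A) {G : A} {S : Finset Coord} (h : ∀ i ∉ S, J.pd i G = 0) :
    J.field v G = ∑ i ∈ S, v i * J.pd i G :=
  J.field_eq_sum' fun i hi => by rw [h i hi, mul_zero]

lemma field_coord (v : Coord → A) (i : Coord) : J.field v (J.coord i) = v i := by
  classical
  rw [J.field_eq_sum v (S := {i})]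
  · simp [J.pd_coord_self]
  · intro j hj
    exact J.pd_coord_ne j i (by simpa using hj)

/-- The second-order terms of the two compositions agree because partial derivatives commute, so the
commutator is again a vector field. -/
lemma field_bracket (v w : Coord → A) (G : A) :
    J.field v (J.field w G) =
      J.field w (J.field v G) + J.field (fun i => J.field v (w i) - J.field w (v i)) G := by
  have h : ∀ i ∉ (J.pd_finite G).toFinset, J.pd i G = 0 := fun i hi => by simpa using hi
  have h2 : ∀ j, ∀ i ∉ (J.pd_finite G).toFinset, J.pd i (J.pd j G) = 0 := fun j i hi => by
    rw [J.pd_comm, h i hi, map_zero]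
  have key : ∀ v w : Coord → A, J.field v (J.field w G) =
      ∑ j ∈ (J.pd_finite G).toFinset, J.field v (w j) * J.pd j G +
      ∑ j ∈ (J.pd_finite G).toFinset, ∑ i ∈ (J.pd_finite G).toFinset,
        w j * v i * J.pd i (J.pd j G) := fun v w => by
    rw [J.field_eq_sum w h, map_sum, ← Finset.sum_add_distrib]
    refine Finset.sum_congr rfl fun j _ => ?_
    rw [Derivation.leibniz, J.field_eq_sum v (h2 j), smul_eq_mul, smul_eq_mul, Finset.mul_sum,
      add_comm, mul_comm]
    simp only [mul_assoc]
  rw [key, key, J.field_eq_sum _ h, Finset.sum_comm]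
  have hs : ∀ i j, w j * v i * J.pd i (J.pd j G) = v i * w j * J.pd j (J.pd i G) := fun i j => by
    rw [J.pd_comm]; ring
  simp only [hs, sub_mul, Finset.sum_sub_distrib]
  ring


lemma pd_field (i : Coord) (v : Coord → A) (G : A) :
    J.pd i (J.field v G) = J.field v (J.pd i G) + J.field (fun j => J.pd i (v j)) G := by
  have h : ∀ j ∉ (J.pd_finite G).toFinset, J.pd j G = 0 := fun j hj => by simpa using hj
  have h2 : ∀ j ∉ (J.pd_finite G).toFinset, J.pd j (J.pd i G) = 0 := fun j hj => by
    rw [J.pd_comm, h j hj, map_zero]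
  rw [J.field_eq_sum v h, J.field_eq_sum _ h, J.field_eq_sum v h2, map_sum,
    ← Finset.sum_add_distrib]
  refine Finset.sum_congr rfl fun j _ => ?_
  rw [Derivation.leibniz, J.pd_comm, smul_eq_mul, smul_eq_mul]
  ring

lemma field_eq_pd {v : Coord → A} {i : Coord} (h : ∀ j, j ≠ i → v j = 0) (G : A) :
    J.field v G = v i * J.pd i G := by
  rw [field_apply]
  exact finsum_eq_single _ i fun j hj => by rw [h j hj, zero_mul]

/-! ### Total derivatives, the Schwarzian and the conjugated linearization. -/

/-- The coordinate `u_k`. -/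
def u (k : ℕ) : A := J.coord (.u k)

/-- The components of the total derivative `D_x`. -/
def dxComp : Coord → A
  | .t => 0
  | .x => 1
  | .u k => J.u (k + 1)

/-- The total derivative `D_x`. -/
def D : Derivation ℝ A A := J.field J.dxComp

/-- `u_2 / u_1`. -/
def a : A := J.u 2 * J.s

/-- The Schwarzian derivative of `u`. -/
def w : A := J.u 3 * J.s - (3 / 2 : ℝ) • J.a ^ 2

/-- The power of `u_1` is chosen so that `D g_j = g_{j+1} + (j - 2) a g_j`; with `a` and the
derivatives of `w` this makes every later computation a polynomial identity. -/
def g0 : A := J.F 0 * J.s ^ 2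
def g1 : A := J.F 1 * J.s
def g2 : A := J.F 2
def g3 : A := J.F 3 * J.u 1
def g4 : A := J.F 4 * J.u 1 ^ 2
def g5 : A := J.F 5 * J.u 1 ^ 3

/-- `u_t / u_1`. -/
def H : A := J.w + J.g0

/-- The components of the total derivative `D_t`. -/
def dtComp : Coord → A
  | .t => 1
  | .x => 0
  | .u k => J.D^[k] (J.u 1 * J.H)

/-- The total derivative `D_t`. -/
def Dt : Derivation ℝ A A := J.field J.dtComp

lemma u_s : J.u 1 * J.s = 1 := J.u_one_mul_s

lemma derivation_s (δ : Derivation ℝ A A) : δ J.s = -(J.s ^ 2 * δ (J.u 1)) := by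
  have h : δ (J.u 1 * J.s) = 0 := by rw [J.u_s, Derivation.map_one_eq_zero]
  rw [Derivation.leibniz, smul_eq_mul, smul_eq_mul] at h
  linear_combination J.s * h - δ J.s * J.u_s

@[simp] lemma derivation_ofNat (δ : Derivation ℝ A A) (n : ℕ) [n.AtLeastTwo] :
    δ (ofNat(n) : A) = 0 := by
  rw [← Nat.cast_ofNat]; exact δ.map_natCast _

lemma field_F (v : Coord → A) (j : ℕ) : J.field v (J.F j) = v (.u 0) * J.F (j + 1) := by
  classical
  rw [J.field_eq_sum v (S := {.u 0})]
  · simp [J.pd_F]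
  · intro i hi
    exact J.pd_F_ne i j (by simpa using hi)

lemma D_u (k : ℕ) : J.D (J.u k) = J.u (k + 1) := J.field_coord _ _
@[simp] lemma D_t : J.D (J.coord .t) = 0 := J.field_coord _ _
@[simp] lemma D_x : J.D (J.coord .x) = 1 := J.field_coord _ _
lemma D_F (j : ℕ) : J.D (J.F j) = J.u 1 * J.F (j + 1) := J.field_F _ _
lemma Dt_u (k : ℕ) : J.Dt (J.u k) = J.D^[k] (J.u 1 * J.H) := J.field_coord _ _
@[simp] lemma Dt_t : J.Dt (J.coord .t) = 1 := J.field_coord _ _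
@[simp] lemma Dt_x : J.Dt (J.coord .x) = 0 := J.field_coord _ _
lemma Dt_F (j : ℕ) : J.Dt (J.F j) = J.u 1 * J.H * J.F (j + 1) := J.field_F _ _

lemma u_two : J.u 2 = J.u 1 * J.a := by
  rw [a]; linear_combination -J.u 2 * J.u_s

lemma D_u_one : J.D (J.u 1) = J.u 1 * J.a := by rw [D_u, ← u_two]

@[simp] lemma D_s : J.D J.s = -(J.a * J.s) := by
  rw [derivation_s, D_u_one]; linear_combination -J.a * J.s * J.u_s

@[simp] lemma D_a : J.D J.a = J.w + (1 / 2 : ℝ) • J.a ^ 2 := by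
  rw [a, Derivation.leibniz, D_s, D_u, w, smul_eq_mul, smul_eq_mul, a]
  algebra

@[simp] lemma D_g0 : J.D J.g0 = J.g1 - 2 * J.a * J.g0 := by
  simp only [g0, g1, Derivation.leibniz, Derivation.leibniz_pow, D_s, D_F, smul_eq_mul, nsmul_eq_mul]
  push_cast
  linear_combination J.F 1 * J.s * J.u_s

@[simp] lemma D_g1 : J.D J.g1 = J.g2 - J.a * J.g1 := by
  simp only [g2, g1, Derivation.leibniz, D_s, D_F, smul_eq_mul]
  linear_combination J.F 2 * J.u_s

@[simp] lemma D_g2 : J.D J.g2 = J.g3 := by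
  simp only [g2, g3, D_F]
  ring

@[simp] lemma D_g3 : J.D J.g3 = J.g4 + J.a * J.g3 := by
  simp only [g3, g4, Derivation.leibniz, D_u_one, D_F, smul_eq_mul]
  ring

@[simp] lemma D_g4 : J.D J.g4 = J.g5 + 2 * J.a * J.g4 := by
  simp only [g4, g5, Derivation.leibniz, Derivation.leibniz_pow, D_u_one, D_F, smul_eq_mul,
    nsmul_eq_mul]
  push_cast
  ring

/-- The commutator is a vector field, so it suffices that its components vanish; on `u_k` this is
the definition of `D_t` by iterating `D`. -/
lemma Dt_D (G : A) : J.Dt (J.D G) = J.D (J.Dt G) := by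
  rw [Dt, D, field_bracket, add_eq_left, field_apply]
  refine finsum_eq_zero_of_forall_eq_zero fun i => mul_eq_zero_of_left ?_ _
  change J.Dt (J.dxComp i) - J.D (J.dtComp i) = 0
  cases i with
  | t => simp [dtComp, dxComp]
  | x => simp [dtComp, dxComp]
  | u k => simp [dtComp, dxComp, Dt_u, Function.iterate_succ_apply']

lemma Dt_u_one : J.Dt (J.u 1) = J.u 1 * (J.a * J.H + J.D J.H) := by
  rw [Dt_u, Function.iterate_one, Derivation.leibniz, D_u_one, smul_eq_mul, smul_eq_mul]
  ring

lemma Dt_s : J.Dt J.s = -(J.s * (J.a * J.H + J.D J.H)) := by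
  rw [derivation_s, Dt_u_one]
  linear_combination -J.s * (J.a * J.H + J.D J.H) * J.u_s

lemma Dt_a : J.Dt J.a = J.D (J.a * J.H + J.D J.H) := by
  have h : J.a = J.D (J.u 1) * J.s := by rw [D_u, a]
  rw [h, Derivation.leibniz, Dt_D, Dt_u_one, Dt_s, ← h, Derivation.leibniz, D_u_one]
  simp only [smul_eq_mul]
  linear_combination (J.D (J.a * J.H + J.D J.H)) * J.u_s

/-- The classical variation of the Schwarzian derivative under `u_t = u_1 H`, obtained from `w = D a
- a^2/2`. -/
lemma Dt_w : J.Dt J.w = J.D (J.D (J.D J.H)) + 2 * J.w * J.D J.H + J.D J.w * J.H := by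
  have h : J.w = J.D J.a - (1 / 2 : ℝ) • J.a ^ 2 := by rw [D_a]; abel
  have h2 : J.D J.w = J.D (J.D J.a) - J.a * J.D J.a := by
    rw [h]; simp [Derivation.leibniz_pow]; algebra
  rw [h2, h, map_sub, Dt_D, Derivation.map_smul, Derivation.leibniz_pow, Dt_a]
  simp only [map_add, Derivation.leibniz, smul_eq_mul, nsmul_eq_mul]
  push_cast
  algebra

lemma Dt_g (j : ℕ) : J.Dt (J.F j) = J.H * J.D (J.F j) := by
  rw [Dt_F, D_F]; ring

/-- A function of `u` is transported by `H D`; each factor `u_1` adds a multiple of `D H`, so the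
last coefficient is the exponent of `u_1`. -/
lemma Dt_g0 : J.Dt J.g0 = J.H * J.D J.g0 - 2 * J.g0 * J.D J.H := by
  simp only [g0, Derivation.leibniz, Derivation.leibniz_pow, D_s, Dt_s, Dt_g, smul_eq_mul,
    nsmul_eq_mul]
  push_cast
  ring

lemma Dt_g1 : J.Dt J.g1 = J.H * J.D J.g1 - J.g1 * J.D J.H := by
  simp only [g1, Derivation.leibniz, D_s, Dt_s, Dt_g, smul_eq_mul]
  ring

lemma Dt_g2 : J.Dt J.g2 = J.H * J.D J.g2 := by
  simp only [g2, Dt_g]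

/-- `u_1⁻¹ (D_t - F_*) u_1`, where `F_*` is the linearization of the right-hand side. -/
def L (G : A) : A := J.Dt G - J.D (J.D (J.D G)) - (3 * J.w - J.g0) * J.D G

lemma L_add (G K : A) : J.L (G + K) = J.L G + J.L K := by simp [L]; ring
lemma L_sub (G K : A) : J.L (G - K) = J.L G - J.L K := by simp [L]; ring
lemma L_smul (c : ℝ) (G : A) : J.L (c • G) = c • J.L G := by simp [L]; algebra
lemma L_mul (G K : A) : J.L (G * K) = G * J.L K + K * J.L G
    - 3 * (J.D G * J.D (J.D K) + J.D (J.D G) * J.D K) := by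
  simp [L]; ring

/-- `u_5 / u_1 - …`, the fifth order flow divided by `u_1`. -/
def R5 : A := J.D (J.D J.w) + (3 / 2 : ℝ) • J.w ^ 2 - (5 / 3 : ℝ) • (J.g0 * J.w)
  - (5 / 3 : ℝ) • (J.g1 * J.a - J.a ^ 2 * J.g0) - (5 / 18 : ℝ) • J.g0 ^ 2 + (5 / 9 : ℝ) • J.g2

/-- Adding the evolutions of `w` and `g0` gives `D_t H = D^3 H + (2w - 2 g0 + H) D H`, and `H = w +
g0`. -/
lemma L_H : J.L J.H = 0 := by
  rw [L, H, map_add, Dt_w, Dt_g0, H]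
  simp only [map_add, D_g0]
  ring

lemma L_a : J.L J.a = -3 * (J.w + (1 / 2 : ℝ) • J.a ^ 2) ^ 2 + J.a * J.g1 - J.a ^ 2 * J.g0
    + (J.g2 - 3 * J.a * J.g1 + 3 * J.a ^ 2 * J.g0) := by
  simp only [L, Dt_a, H, map_add, Derivation.leibniz, D_g0, D_a, D_g1, map_sub,
    Derivation.map_smul, Derivation.leibniz_pow, smul_eq_mul, nsmul_eq_mul, derivation_ofNat,
    Nat.cast_ofNat, Nat.add_one_sub_one, pow_one]
  algebra

/-- The defect has order one and vanishes exactly when `f^(5)` does. For arbitrary `f`, `R5`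
therefore still serves to normalize the leading term of order five. -/
lemma L_R5 : J.L J.R5 = (4 / 9 : ℝ) • J.g5 := by
  simp only [L, R5, map_add, map_sub, Derivation.map_smul, Derivation.leibniz,
    Derivation.leibniz_pow, Dt_D, Dt_w, Dt_g0, Dt_g1, Dt_g2, Dt_a, H, D_g0, D_g1, D_g2, D_g3,
    D_g4, D_a, smul_eq_mul, nsmul_eq_mul, derivation_ofNat, pow_one,
    Nat.add_one_sub_one, Nat.cast_ofNat, mul_zero, add_zero]
  algebra


/-! ### Differential order and leading coefficients. -/

/-- `G` does not depend on `u_k` for `k > n`. -/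
abbrev OrdLE (n : ℕ) (G : A) : Prop := ∀ k, n < k → J.pd (.u k) G = 0

variable {J}

lemma OrdLE.mono {m n : ℕ} {G : A} (h : J.OrdLE m G) (hmn : m ≤ n) : J.OrdLE n G :=
  fun k hk => h k (hmn.trans_lt hk)

lemma OrdLE.add {n : ℕ} {G K : A} (hG : J.OrdLE n G) (hK : J.OrdLE n K) : J.OrdLE n (G + K) :=
  fun k hk => by rw [map_add, hG k hk, hK k hk, add_zero]

lemma OrdLE.sub {n : ℕ} {G K : A} (hG : J.OrdLE n G) (hK : J.OrdLE n K) : J.OrdLE n (G - K) :=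
  fun k hk => by rw [map_sub, hG k hk, hK k hk, sub_zero]

lemma OrdLE.mul {n : ℕ} {G K : A} (hG : J.OrdLE n G) (hK : J.OrdLE n K) : J.OrdLE n (G * K) :=
  fun k hk => by rw [Derivation.leibniz, hG k hk, hK k hk, smul_zero, smul_zero, add_zero]

lemma OrdLE.pow {n : ℕ} {G : A} (hG : J.OrdLE n G) (m : ℕ) : J.OrdLE n (G ^ m) :=
  fun k hk => by rw [Derivation.leibniz_pow, hG k hk, smul_zero, smul_zero]

lemma OrdLE.smul {n : ℕ} {G : A} (hG : J.OrdLE n G) (c : ℝ) : J.OrdLE n (c • G) :=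
  fun k hk => by rw [Derivation.map_smul, hG k hk, smul_zero]

lemma OrdLE.sub_of_eq {n : ℕ} {G K : A} (hG : J.OrdLE (n + 1) G) (hK : J.OrdLE (n + 1) K)
    (h : J.pd (.u (n + 1)) G = J.pd (.u (n + 1)) K) : J.OrdLE n (G - K) := fun k hk => by
  rcases Nat.lt_or_ge (n + 1) k with hk' | hk'
  · exact hG.sub hK k hk'
  · obtain rfl : k = n + 1 := by omega
    rw [map_sub, h, sub_self]

variable (J)

lemma exists_ordLE (G : A) : ∃ n, J.OrdLE n G := by
  have h : {k | J.pd (.u k) G ≠ 0}.Finite :=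
    ((J.pd_finite G).preimage fun a _ b _ h => by cases h; rfl)
  obtain ⟨n, hn⟩ := h.bddAbove
  exact ⟨n, fun k hk => by_contra fun h' => absurd (hn h') (by omega)⟩

lemma pd_u_ne {k j : ℕ} (h : k ≠ j) : J.pd (.u k) (J.u j) = 0 :=
  J.pd_coord_ne _ _ fun h' => h (by cases h'; rfl)

lemma pd_u_self (k : ℕ) : J.pd (.u k) (J.u k) = 1 := J.pd_coord_self _

@[simp] lemma pd_u_x (k : ℕ) : J.pd (.u k) (J.coord .x) = 0 := J.pd_coord_ne _ _ (by simp)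

lemma pd_u_t (k : ℕ) : J.pd (.u k) (J.coord .t) = 0 := J.pd_coord_ne _ _ (by simp)

lemma ordLE_u {n k : ℕ} (h : k ≤ n) : J.OrdLE n (J.u k) := fun _ hj => J.pd_u_ne (by omega)

lemma ordLE_x (n : ℕ) : J.OrdLE n (J.coord .x) := fun k _ => J.pd_u_x k

lemma ordLE_F (n j : ℕ) : J.OrdLE n (J.F j) := fun k hk =>
  J.pd_F_ne _ _ fun h => by cases h; omega

/-- Among the components of `D` only that along `u_k` contains `u_{k+1}`, hence `[∂_{u_{k+1}}, D] =
∂_{u_k}`. -/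
lemma pd_succ_D (k : ℕ) (G : A) :
    J.pd (.u (k + 1)) (J.D G) = J.D (J.pd (.u (k + 1)) G) + J.pd (.u k) G := by
  rw [D, pd_field, J.field_eq_pd (v := fun j => J.pd _ (J.dxComp j)) (i := .u k)]
  · simp only [dxComp, pd_u_self, one_mul]
  · rintro (_ | _ | j) hj
    · simp [dxComp]
    · simp [dxComp]
    · exact J.pd_u_ne fun h => hj (by congr 1; omega)

lemma pd_D_comm {i : Coord} (hi : ∀ k, i ≠ .u (k + 1)) (G : A) :
    J.pd i (J.D G) = J.D (J.pd i G) := by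
  -- All components of the commutator vanish; `.t` is an arbitrary choice of the index kept in the
  -- sum.
  rw [D, pd_field, add_eq_left, J.field_eq_pd (v := fun j => J.pd _ (J.dxComp j)) (i := .t)]
  · simp [dxComp]
  · rintro (_ | _ | j) hj
    · simp [dxComp]
    · simp [dxComp]
    · exact J.pd_coord_ne _ _ (hi j)

lemma D_eq_sum {n : ℕ} {G : A} (h : J.OrdLE n G) :
    J.D G = J.pd .x G + ∑ k ∈ Finset.range (n + 1), J.u (k + 1) * J.pd (.u k) G := by
  classical
  rw [D, J.field_eq_sum' (S := insert .x ((Finset.range (n + 1)).image .u))]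
  · rw [Finset.sum_insert (by simp), Finset.sum_image (fun a _ b _ h => by cases h; rfl)]
    simp [dxComp]
  · rintro (_ | _ | j) hj
    · simp [dxComp]
    · simp at hj
    · rw [h j (by simpa using hj), mul_zero]

variable {J}

lemma OrdLE.D {n : ℕ} {G : A} (h : J.OrdLE n G) : J.OrdLE (n + 1) (J.D G) := fun k hk => by
  obtain ⟨k, rfl⟩ : ∃ j, k = j + 1 := ⟨k - 1, by omega⟩
  rw [pd_succ_D, h _ (by omega), h _ (by omega), map_zero, add_zero]

lemma OrdLE.pd_D {n : ℕ} {G : A} (h : J.OrdLE n G) :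
    J.pd (.u (n + 1)) (J.D G) = J.pd (.u n) G := by
  rw [pd_succ_D, h _ (by omega), map_zero, zero_add]

/-- Descending induction from the order of `G`: by `pd_succ_D`, if the `u_{k+1}`-derivative vanishes
then so does the `u_k`-derivative. With `pd_x_of_D_eq_zero`, only `t` remains. -/
lemma pd_u_of_D_eq_zero {G : A} (h : J.D G = 0) (k : ℕ) : J.pd (.u k) G = 0 := by
  obtain ⟨n, hn⟩ := J.exists_ordLE G
  suffices H : ∀ m k, n < k + m → J.pd (.u k) G = 0 from H (n + 1) k (by omega)
  intro m
  induction m with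
  | zero => exact fun k hk => hn k hk
  | succ m ih =>
    intro k hk
    have h2 := J.pd_succ_D k G
    rw [h, map_zero, ih (k + 1) (by omega), map_zero, zero_add] at h2
    exact h2.symm

lemma ordLE_of_D_eq_zero {G : A} (h : J.D G = 0) (n : ℕ) : J.OrdLE n G :=
  fun k _ => pd_u_of_D_eq_zero h k

lemma pd_x_of_D_eq_zero {G : A} (h : J.D G = 0) : J.pd .x G = 0 := by
  have h2 := J.D_eq_sum (ordLE_of_D_eq_zero h 0)
  rw [h, Finset.sum_eq_zero fun k _ => by rw [pd_u_of_D_eq_zero h, mul_zero], add_zero] at h2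
  exact h2.symm

lemma D_Dt_eq_zero {G : A} (h : J.D G = 0) : J.D (J.Dt G) = 0 := by
  rw [← Dt_D, h, map_zero]

variable (J)

@[simp] lemma ordLE_s : J.OrdLE 1 J.s := fun k hk => by
  rw [derivation_s, J.pd_u_ne (by omega), mul_zero, neg_zero]

@[simp] lemma ordLE_a : J.OrdLE 2 J.a :=
  (J.ordLE_u (le_refl 2)).mul (J.ordLE_s.mono (by omega))

@[simp] lemma ordLE_w : J.OrdLE 3 J.w :=
  ((J.ordLE_u (le_refl 3)).mul (J.ordLE_s.mono (by omega))).sub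
    (((J.ordLE_a.mono (by omega)).pow 2).smul _)

@[simp] lemma ordLE_g0 : J.OrdLE 1 J.g0 := (J.ordLE_F 1 0).mul (J.ordLE_s.pow 2)
@[simp] lemma ordLE_g1 : J.OrdLE 1 J.g1 := (J.ordLE_F 1 1).mul J.ordLE_s
@[simp] lemma ordLE_g2 : J.OrdLE 1 J.g2 := J.ordLE_F 1 2
@[simp] lemma ordLE_g3 : J.OrdLE 1 J.g3 := (J.ordLE_F 1 3).mul (J.ordLE_u (le_refl 1))
@[simp] lemma ordLE_g4 : J.OrdLE 1 J.g4 := (J.ordLE_F 1 4).mul ((J.ordLE_u (le_refl 1)).pow 2)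
@[simp] lemma ordLE_g5 : J.OrdLE 1 J.g5 := (J.ordLE_F 1 5).mul ((J.ordLE_u (le_refl 1)).pow 3)

@[simp] lemma pd_two_a : J.pd (.u 2) J.a = J.s := by
  rw [a, Derivation.leibniz, J.ordLE_s 2 (by omega), pd_u_self]; simp

@[simp] lemma pd_three_w : J.pd (.u 3) J.w = J.s := by
  rw [w, map_sub, Derivation.leibniz, J.ordLE_s 3 (by omega), pd_u_self,
    (((J.ordLE_a.pow 2).smul _) 3 (by omega))]; simp

@[simp] lemma ordLE_Dg5 : J.OrdLE 2 (J.D J.g5) := J.ordLE_g5.D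
@[simp] lemma ordLE_Dw : J.OrdLE 4 (J.D J.w) := J.ordLE_w.D
@[simp] lemma ordLE_DDw : J.OrdLE 5 (J.D (J.D J.w)) := J.ordLE_w.D.D
@[simp] lemma ordLE_DDDw : J.OrdLE 6 (J.D (J.D (J.D J.w))) := J.ordLE_w.D.D.D

@[simp] lemma pd_four_Dw : J.pd (.u 4) (J.D J.w) = J.s := by rw [J.ordLE_w.pd_D, pd_three_w]
@[simp] lemma pd_five_DDw : J.pd (.u 5) (J.D (J.D J.w)) = J.s := by rw [J.ordLE_w.D.pd_D, pd_four_Dw]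
@[simp] lemma pd_six_DDDw : J.pd (.u 6) (J.D (J.D (J.D J.w))) = J.s := by
  rw [J.ordLE_w.D.D.pd_D, pd_five_DDw]

lemma ordLE_dtComp (k : ℕ) : J.OrdLE (k + 3) (J.dtComp (.u k)) := by
  rw [dtComp]
  induction k with
  | zero =>
    exact (J.ordLE_u (by omega)).mul (J.ordLE_w.add (J.ordLE_g0.mono (by omega)))
  | succ k ih => rw [Function.iterate_succ_apply']; exact ih.D

lemma pd_dtComp (k : ℕ) : J.pd (.u (k + 3)) (J.dtComp (.u k)) = 1 := by
  induction k with
  | zero =>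
    simp only [dtComp, Function.iterate_zero, id_eq, H, zero_add]
    rw [Derivation.leibniz, map_add, pd_three_w, J.ordLE_g0 3 (by omega), J.pd_u_ne (by omega),
      smul_zero, add_zero, add_zero, smul_eq_mul, u_s]
  | succ k ih =>
    rw [← ih, ← (J.ordLE_dtComp k).pd_D, dtComp, Function.iterate_succ_apply']; rfl

lemma pd_two_w : J.pd (.u 2) J.w = -(3 * J.a * J.s) := by
  rw [w, map_sub, Derivation.leibniz, J.ordLE_s 2 (by omega), J.pd_u_ne (by omega),
    Derivation.map_smul, Derivation.leibniz_pow, pd_two_a]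
  simp
  algebra

/-- The subleading coefficient does not change with `k` because the leading one is the constant `1`,
whose total derivative is zero. -/
lemma pd_dtComp' (k : ℕ) : J.pd (.u (k + 2)) (J.dtComp (.u k)) = -(3 * J.a) := by
  induction k with
  | zero =>
    simp only [dtComp, Function.iterate_zero, id_eq, H, zero_add]
    rw [Derivation.leibniz, map_add, pd_two_w, J.ordLE_g0 2 (by omega), J.pd_u_ne (by omega),
      smul_zero, add_zero, add_zero, smul_eq_mul]
    linear_combination -3 * J.a * J.u_s
  | succ k ih =>
    have h := J.pd_succ_D (k + 2) (J.dtComp (.u k))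
    rw [J.pd_dtComp, Derivation.map_one_eq_zero, zero_add, ih] at h
    rw [← h, dtComp, dtComp, Function.iterate_succ_apply']

lemma pd_Dt {m : ℕ} {G : A} (h : J.OrdLE (m + 1) G) :
    J.pd (.u (m + 3)) (J.Dt G) = J.pd (.u m) G - 3 * J.a * J.pd (.u (m + 1)) G := by
  classical
  rw [Dt, pd_field, h _ (by omega), map_zero, zero_add,
    -- For smaller indices the component of `D_t` does not reach `u_{m+3}`; for larger ones `G` has
    -- no dependence.
    J.field_eq_sum' (S := {.u m, .u (m + 1)})]
  · rw [Finset.sum_pair (by simp), J.pd_dtComp, J.pd_dtComp' (m + 1)]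
    ring
  · rintro (_ | _ | j) hj
    · simp [dtComp]
    · simp [dtComp]
    · simp only [Finset.mem_insert, Finset.mem_singleton, not_or, Coord.u.injEq] at hj
      rcases Nat.lt_or_ge j m with hjm | hjm
      · rw [J.ordLE_dtComp j _ (by omega), zero_mul]
      · rw [h j (by omega), mul_zero]

lemma pd_DDD {m : ℕ} {G : A} (h : J.OrdLE (m + 1) G) :
    J.pd (.u (m + 3)) (J.D (J.D (J.D G))) = J.pd (.u m) G + 3 * J.D (J.pd (.u (m + 1)) G) := by
  have h2 : J.pd (.u (m + 2)) (J.D G) = J.pd (.u (m + 1)) G := h.pd_D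
  rw [J.pd_succ_D (m + 2), J.pd_succ_D (m + 2), h.D (m + 2 + 1) (by omega),
    J.pd_succ_D (m + 1) (J.D G), h2, J.pd_succ_D m]
  simp only [map_zero, map_add]
  ring

/-- The highest-order part of `L`. -/
lemma pd_L {m : ℕ} {G : A} (h : J.OrdLE (m + 2) G) :
    J.pd (.u (m + 4)) (J.L G) = -3 * J.s * J.D (J.u 1 * J.pd (.u (m + 2)) G) := by
  -- With `g = ∂G/∂u_{m+2}`, the terms `∂G/∂u_{m+1}` of `D_t` and `D^3` cancel and `-3 (D g + a g) =
  -- -3 s D(u_1 g)` is left; the first-order term of `L` does not reach `u_{m+4}`.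
  rw [L, map_sub, map_sub, J.pd_Dt h, J.pd_DDD h, Derivation.leibniz, h.D _ (by omega), map_sub,
    Derivation.leibniz, J.ordLE_w _ (by omega), J.ordLE_g0 _ (by omega), derivation_ofNat,
    Derivation.leibniz, D_u_one]
  simp only [smul_eq_mul]
  linear_combination (3 * J.D (J.pd (.u (m + 2)) G) +
    3 * J.a * J.pd (.u (m + 2)) G) * J.u_s

/-- Order one is exceptional: `w` itself contains `u_3`, so the term `-3 w D G` contributes `-3 s D
G`. -/
lemma pd_L_one {G : A} (h : J.OrdLE 1 G) :
    J.pd (.u 3) (J.L G) = -3 * J.s * J.D (J.u 1 * J.pd (.u 1) G + G) := by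
  have e := J.pd_DDD (m := 0) h
  have e2 := J.pd_Dt (m := 0) h
  simp only [zero_add] at e e2
  rw [L, map_sub, map_sub, e, e2, Derivation.leibniz, h.D _ (by omega), map_sub,
    Derivation.leibniz, pd_three_w, J.ordLE_g0 _ (by omega), derivation_ofNat,
    map_add, Derivation.leibniz, D_u_one]
  simp only [smul_eq_mul]
  linear_combination (3 * J.D (J.pd (.u 1) G) + 3 * J.a * J.pd (.u 1) G) * J.u_s


/-! ### Exclusion of order six. -/

variable {J} in
lemma eq_zero_of_s_mul {X : A} (h : J.s * X = 0) : X = 0 := by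
  linear_combination J.u 1 * h - X * J.u_s

variable {J} in
lemma D_eq_zero_of_top {m : ℕ} {G : A} (h : J.OrdLE (m + 2) G)
    (hL : J.pd (.u (m + 4)) (J.L G) = 0) : J.D (J.u 1 * J.pd (.u (m + 2)) G) = 0 := by
  rw [pd_L J h] at hL
  apply eq_zero_of_s_mul (J := J)
  linear_combination (norm := algebra) (-(1 / 3 : ℝ)) • hL

/-- `D` commutes with `D_t`, so only the coefficient `3w - g0` contributes. Iterating from `L_w`
gives `L` on all derivatives of `w`. -/
lemma L_D (G : A) : J.L (J.D G) = J.D (J.L G) + (3 * J.D J.w - J.D J.g0) * J.D G := by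
  simp only [L, Dt_D, map_sub, Derivation.leibniz, smul_eq_mul, derivation_ofNat]
  ring

variable {J} in
lemma L_const_mul {α : A} (h : J.D α = 0) (G : A) : J.L (α * G) = α * J.L G + J.Dt α * G := by
  have : J.L α = J.Dt α := by simp [L, h]
  rw [L_mul, this, h]
  simp
  ring

lemma L_x : J.L (J.coord .x) = -(3 * J.w - J.g0) := by
  simp [L, D_x, Dt_x]

/-- The Schwarzian KdV part cancels, so only terms with `f` and its derivatives survive and the
order stays at three. -/
lemma L_w : J.L J.w = J.g3 - 3 * J.a * J.g2 + (9 / 2 : ℝ) • (J.a ^ 2 * J.g1) - 3 * J.w * J.g1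
    + 6 * J.a * J.w * J.g0 - 3 * J.a ^ 3 * J.g0 := by
  simp [L, Dt_w, H, Derivation.leibniz_pow]
  algebra

set_option maxHeartbeats 1000000 in
-- Three uses of `L_D` produce the square `9 (D^2 w)^2`, whence `18 s^2`.
lemma pd_five_five_L_DDDw : J.pd (.u 5) (J.pd (.u 5) (J.L (J.D (J.D (J.D J.w))))) = 18 * J.s ^ 2 +
    (12 * J.D J.w - 6 * J.D J.g0) * J.pd (.u 5) (J.pd (.u 5) (J.D (J.D (J.D J.w)))) := by
  simp [L_D, L_w, Derivation.leibniz_pow]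
  algebra

lemma pd_five_five_L_DDw : J.pd (.u 5) (J.pd (.u 5) (J.L (J.D (J.D J.w)))) = 0 := by
  simp [L_D, L_w, Derivation.leibniz_pow]

lemma pd_five_L_Dw : J.pd (.u 5) (J.L (J.D J.w)) = 0 := by
  simp [L_D, L_w, Derivation.leibniz_pow]

lemma pd_six_L_DDDw : J.pd (.u 6) (J.L (J.D (J.D (J.D J.w)))) =
    J.s * (12 * J.D J.w - 6 * (J.g1 - 2 * J.a * J.g0)) := by
  simp [L_D, L_w, Derivation.leibniz_pow]
  algebra

lemma pd_seven_L_DDDw : J.pd (.u 7) (J.L (J.D (J.D (J.D J.w)))) = 0 := by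
  simp [L_D, L_w, Derivation.leibniz_pow]

lemma pd_six_L_DDw : J.pd (.u 6) (J.L (J.D (J.D J.w))) = 0 := by
  simp [L_D, L_w, Derivation.leibniz_pow]

variable {J} in
theorem ordLE_five {R : A} (h : J.OrdLE 6 R) (hL : J.L R = 0) : J.OrdLE 5 R := by
  obtain ⟨α, hα_def⟩ : ∃ α, α = J.u 1 * J.pd (.u 6) R := ⟨_, rfl⟩
  have hα : J.D α = 0 := hα_def ▸ D_eq_zero_of_top (m := 4) h (by rw [hL, map_zero])
  have hα' := D_Dt_eq_zero hα
  have hα'' := D_Dt_eq_zero hα'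
  obtain ⟨S, hS_def⟩ : ∃ S, S = R - α * J.D (J.D (J.D J.w)) := ⟨_, rfl⟩
  have hS : J.OrdLE 5 S := by
    rw [hS_def]
    refine h.sub_of_eq ((ordLE_of_D_eq_zero hα 6).mul J.ordLE_w.D.D.D) ?_
    rw [Derivation.leibniz, pd_six_DDDw, pd_u_of_D_eq_zero hα, smul_zero, add_zero, hα_def,
      smul_eq_mul]
    linear_combination -J.pd (.u 6) R * J.u_s
  have hLS : J.L S = -(α * J.L (J.D (J.D (J.D J.w))) + J.Dt α * J.D (J.D (J.D J.w))) := by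
    rw [hS_def, L_sub, hL, L_const_mul hα, zero_sub]
  have hL3 := J.pd_six_L_DDDw
  have hL3' := J.pd_seven_L_DDDw
  have hL2 := J.pd_six_L_DDw
  have hu := fun k => pd_u_of_D_eq_zero hα k
  have hu' := fun k => pd_u_of_D_eq_zero hα' k
  obtain ⟨β, hβ_def⟩ : ∃ β, β = J.u 1 * J.pd (.u 5) S := ⟨_, rfl⟩
  have hβ : J.D β = 0 := hβ_def ▸ D_eq_zero_of_top (m := 3) hS (by simp [hLS, hL3', hu, hu'])
  have hβ' := D_Dt_eq_zero hβ
  have hv := fun k => pd_u_of_D_eq_zero hβ k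
  have hv' := fun k => pd_u_of_D_eq_zero hβ' k
  obtain ⟨Q, hQ_def⟩ : ∃ Q, Q = S - β * J.D (J.D J.w) := ⟨_, rfl⟩
  have hQ : J.OrdLE 4 Q := by
    rw [hQ_def]
    refine hS.sub_of_eq ((ordLE_of_D_eq_zero hβ 5).mul J.ordLE_w.D.D) ?_
    rw [Derivation.leibniz, pd_five_DDw, hv, smul_zero, add_zero, hβ_def, smul_eq_mul]
    linear_combination -J.pd (.u 5) S * J.u_s
  have hLQ : J.L Q = J.L S - (β * J.L (J.D (J.D J.w)) + J.Dt β * J.D (J.D J.w)) := by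
    rw [hQ_def, L_sub, L_const_mul hβ]
  -- The `u_6`-derivative of `L Q` prescribes `D(u_1 ∂Q/∂u_4) = α (4 D w - 2 D g0) + α_t / 3`; the
  -- subtracted terms are a primitive.
  obtain ⟨Y, hY_def⟩ : ∃ Y, Y = J.u 1 * J.pd (.u 4) Q - α * (4 * J.w - 2 * J.g0)
    - (1 / 3 : ℝ) • (J.Dt α * J.coord .x) := ⟨_, rfl⟩
  have hY : J.D Y = 0 := by
    have h2 := J.pd_L (m := 2) hQ
    rw [hLQ, hLS] at h2
    simp only [map_sub, map_neg, map_add, Derivation.leibniz, hL3, hL2, hu, hu', hv, hv'] at h2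
    apply eq_zero_of_s_mul (J := J)
    rw [hY_def]
    simp [hα, hα'] at h2 ⊢
    linear_combination (norm := algebra) (1 / 3 : ℝ) • h2
  have hY' := D_Dt_eq_zero hY
  have hy := fun k => pd_u_of_D_eq_zero hY k
  have hy' := fun k => pd_u_of_D_eq_zero hY' k
  have hu'' := fun k => pd_u_of_D_eq_zero hα'' k
  obtain ⟨e, he⟩ : ∃ e, e = Y + α * (4 * J.w - 2 * J.g0) + (1 / 3 : ℝ) • (J.Dt α * J.coord .x) :=
    ⟨_, rfl⟩
  have he_ord : J.OrdLE 3 e := fun k hk => by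
    simp [he, hy, hu, hu', J.ordLE_w k hk, J.ordLE_g0 k (by omega)]
  obtain ⟨Z, hZ_def⟩ : ∃ Z, Z = Q - e * J.D J.w := ⟨_, rfl⟩
  have hZ : J.OrdLE 3 Z := by
    rw [hZ_def]
    refine hQ.sub_of_eq ((he_ord.mono (by omega)).mul J.ordLE_w.D) ?_
    rw [Derivation.leibniz, pd_four_Dw, he_ord 4 (by omega), smul_zero, add_zero, he, hY_def,
      smul_eq_mul]
    linear_combination -J.pd (.u 4) Q * J.u_s
  have hLZ : J.L Z = J.L Q - J.L (e * J.D J.w) := by rw [hZ_def, L_sub]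
  -- `Z` has order three, so `∂_{u_5} L Z` has order at most four by `pd_L`: no `u_5^2` can occur in
  -- `L Z`.
  have hdd : J.pd (.u 5) (J.pd (.u 5) (J.L Z)) = 0 := by
    rw [J.pd_L (m := 1) hZ]
    have h3 : J.OrdLE 3 (J.u 1 * J.pd (.u 3) Z) := (J.ordLE_u (by omega)).mul fun k hk => by
      rw [J.pd_comm, hZ k hk, map_zero]
    rw [Derivation.leibniz, h3.D 5 (by omega)]
    simp
  have h0 : J.pd (.u 5) (J.L e) = 0 := by
    rw [J.pd_L (m := 1) he_ord]
    have : J.u 1 * J.pd (.u 3) e = 4 * α := by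
      simp [he, hy, hu, hu']
      linear_combination 4 * α * J.u_s
    rw [this]
    simp [hα]
  have hDe : J.D e = α * (4 * J.D J.w - 2 * J.D J.g0) + (1 / 3 : ℝ) • J.Dt α := by
    simp [he, hY, hα, hα']
  have hDDe : J.D (J.D e) = α * (4 * J.D (J.D J.w) - 2 * J.D (J.D J.g0)) := by
    rw [hDe]
    simp [hα, hα']
  have he5 := he_ord 5 (by omega)
  rw [hLZ, hLQ, hLS, L_mul, hDDe, hDe] at hdd
  simp [pd_five_five_L_DDDw, pd_five_five_L_DDw, pd_five_L_Dw, h0, he5, hu, hu', hv, hv'] at hdd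
  -- The contribution `-18 α s^2` of `α D^3 w` meets `+24 α s^2`, which comes from `D^2 e` in `L (e
  -- D w)`; `6 α s^2` is left.
  have hα0 : α = 0 := by
    apply eq_zero_of_s_mul (J := J)
    apply eq_zero_of_s_mul (J := J)
    linear_combination (norm := algebra) (1 / 6 : ℝ) • hdd
  intro k hk
  rcases Nat.lt_or_ge 6 k with hk' | hk'
  · exact h k hk'
  · obtain rfl : k = 6 := by omega
    linear_combination J.s * hα0 - J.s * hα_def - J.pd (.u 6) R * J.u_s


/-! ### Descent from order five to functions of `t, x, u`. -/

@[simp] lemma ordLE_R5 : J.OrdLE 5 J.R5 := fun k hk => by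
  have h1 := J.ordLE_a k (by omega)
  have h2 := J.ordLE_w k (by omega)
  have h3 := J.ordLE_g0 k (by omega)
  have h4 := J.ordLE_g1 k (by omega)
  have h5 := J.ordLE_g2 k (by omega)
  have h6 := J.ordLE_DDw k hk
  simp [R5, h1, h2, h3, h4, h5, h6, Derivation.leibniz_pow]

@[simp] lemma pd_five_R5 : J.pd (.u 5) J.R5 = J.s := by
  simp [R5, Derivation.leibniz_pow]

variable {J}

theorem exists_ordLE_two {R : A} (h : J.OrdLE 5 R) (hL : J.L R = 0) :
    ∃ β γ δ G, J.D β = 0 ∧ J.D γ = 0 ∧ J.D δ = 0 ∧ J.OrdLE 2 G ∧ R = β * J.R5 + γ * J.D J.w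
      + δ * J.H + (1 / 3 : ℝ) • (J.Dt β * (J.coord .x * J.w)) + G := by
  obtain ⟨β, hβ_def⟩ : ∃ β, β = J.u 1 * J.pd (.u 5) R := ⟨_, rfl⟩
  have hβ : J.D β = 0 := hβ_def ▸ D_eq_zero_of_top (m := 3) h (by rw [hL, map_zero])
  have hβ' := D_Dt_eq_zero hβ
  have hu := fun k => pd_u_of_D_eq_zero hβ k
  have hu' := fun k => pd_u_of_D_eq_zero hβ' k
  obtain ⟨R₁, hR₁_def⟩ : ∃ R₁, R₁ = R - β * J.R5 := ⟨_, rfl⟩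
  have hR₁ : J.OrdLE 4 R₁ := by
    rw [hR₁_def]
    refine h.sub_of_eq ((ordLE_of_D_eq_zero hβ 5).mul J.ordLE_R5) ?_
    rw [Derivation.leibniz, pd_five_R5, hu, smul_zero, add_zero, hβ_def, smul_eq_mul]
    linear_combination -J.pd (.u 5) R * J.u_s
  have hL₁ : J.L R₁ = -(β * (4 / 9 : ℝ) • J.g5 + J.Dt β * J.R5) := by
    rw [hR₁_def, L_sub, hL, L_const_mul hβ, L_R5, zero_sub]
  obtain ⟨γ, hγ_def⟩ : ∃ γ, γ = J.u 1 * J.pd (.u 4) R₁ := ⟨_, rfl⟩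
  have hγ : J.D γ = 0 := hγ_def ▸ D_eq_zero_of_top (m := 2) hR₁ (by simp [hL₁, hu, hu'])
  have hγ' := D_Dt_eq_zero hγ
  have hv := fun k => pd_u_of_D_eq_zero hγ k
  have hv' := fun k => pd_u_of_D_eq_zero hγ' k
  obtain ⟨R₂, hR₂_def⟩ : ∃ R₂, R₂ = R₁ - γ * J.D J.w := ⟨_, rfl⟩
  have hR₂ : J.OrdLE 3 R₂ := by
    rw [hR₂_def]
    refine hR₁.sub_of_eq ((ordLE_of_D_eq_zero hγ 4).mul J.ordLE_Dw) ?_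
    rw [Derivation.leibniz, pd_four_Dw, hv, smul_zero, add_zero, hγ_def, smul_eq_mul]
    linear_combination -J.pd (.u 4) R₁ * J.u_s
  -- The term `β_t R5` in `L R₂` forces `D(u_1 ∂R₂/∂u_3) = β_t / 3`, which integrates to an explicit
  -- `x`.
  obtain ⟨δ, hδ_def⟩ : ∃ δ, δ = J.u 1 * J.pd (.u 3) R₂ - (1 / 3 : ℝ) • (J.Dt β * J.coord .x) :=
    ⟨_, rfl⟩
  have hδ : J.D δ = 0 := by
    have h2 := J.pd_L (m := 1) hR₂
    rw [hR₂_def, L_sub, hL₁, L_const_mul hγ, ← hR₂_def] at h2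
    simp only [map_sub, map_neg, map_add, Derivation.leibniz, hu, hu', hv, hv'] at h2
    apply eq_zero_of_s_mul (J := J)
    rw [hδ_def]
    simp [hβ', pd_five_L_Dw] at h2 ⊢
    linear_combination (norm := algebra) (-(1 / 3 : ℝ)) • h2
  have hz := fun k => pd_u_of_D_eq_zero hδ k
  refine ⟨β, γ, δ, R₂ - (δ * J.H + (1 / 3 : ℝ) • (J.Dt β * (J.coord .x * J.w))),
    hβ, hγ, hδ, ?_, ?_⟩
  · refine hR₂.sub_of_eq (((ordLE_of_D_eq_zero hδ 3).mul
      (J.ordLE_w.add (J.ordLE_g0.mono (by omega)))).add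
      (((ordLE_of_D_eq_zero hβ' 3).mul ((J.ordLE_x 3).mul J.ordLE_w)).smul _)) ?_
    simp [H, hz, hu']
    rw [hδ_def]
    linear_combination (norm := algebra) -J.pd (.u 3) R₂ * J.u_s
  · rw [hR₂_def, hR₁_def]
    ring

lemma pd_four_four_L_Dw : J.pd (.u 4) (J.pd (.u 4) (J.L (J.D J.w))) = 6 * J.s ^ 2 := by
  simp [L_D, L_w, Derivation.leibniz_pow]
  ring

lemma eq_zero_of_s_sq_mul {c : ℝ} (hc : c ≠ 0) {X : A} (h : c • (J.s ^ 2 * X) = 0) : X = 0 := by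
  apply eq_zero_of_s_mul (J := J)
  apply eq_zero_of_s_mul (J := J)
  rw [smul_eq_zero_iff_right hc] at h
  rw [← h]; ring

theorem exists_ordLE_zero {R : A} (h : J.OrdLE 5 R) (hL : J.L R = 0) :
    ∃ β δ ζ q, J.D β = 0 ∧ J.Dt β = 0 ∧ J.D δ = 0 ∧ J.D ζ = 0 ∧ J.OrdLE 0 q ∧
      R = β * J.R5 + δ * J.H + (1 / 3 : ℝ) • (J.Dt δ * J.coord .x) + ζ + q * J.s := by
  obtain ⟨β, γ, δ, G, hβ, hγ, hδ, hG, hR⟩ := exists_ordLE_two h hL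
  have hβ' := D_Dt_eq_zero hβ
  have hβ'' := D_Dt_eq_zero hβ'
  have hγ' := D_Dt_eq_zero hγ
  have hδ' := D_Dt_eq_zero hδ
  have hu := fun k => pd_u_of_D_eq_zero hβ k
  have hu' := fun k => pd_u_of_D_eq_zero hβ' k
  have hu'' := fun k => pd_u_of_D_eq_zero hβ'' k
  have hv := fun k => pd_u_of_D_eq_zero hγ k
  have hv' := fun k => pd_u_of_D_eq_zero hγ' k
  have hz' := fun k => pd_u_of_D_eq_zero hδ' k
  have hLG : J.L G = -(β * (4 / 9 : ℝ) • J.g5 + J.Dt β * J.R5) -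
      (γ * J.L (J.D J.w) + J.Dt γ * J.D J.w) - J.Dt δ * (J.w + J.g0) -
      (1 / 3 : ℝ) • (J.Dt β * (J.coord .x * J.L J.w + J.w * (-(3 * J.w - J.g0))
        - 3 * J.D (J.D J.w)) + J.Dt (J.Dt β) * (J.coord .x * J.w)) := by
    rw [hR] at hL
    simp only [L_add, L_smul, L_const_mul hβ, L_const_mul hγ, L_const_mul hδ, L_const_mul hβ',
      L_mul J (J.coord .x), L_R5, L_H, L_x, D_x, Derivation.map_one_eq_zero] at hL
    rw [← H]
    linear_combination (norm := algebra) hL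
  -- `L G` has no `u_4^2` since `G` has order two, while `L (D w)` contains `3 (D w)^2`.
  have hγ0 : γ = 0 := by
    have h2 := J.pd_L (m := 0) hG
    rw [hLG] at h2
    have h3 := congrArg (J.pd (.u 4)) h2
    have h4 : J.OrdLE 2 (J.u 1 * J.pd (.u 2) G) := (J.ordLE_u (by omega)).mul fun k hk => by
      rw [J.pd_comm, hG k hk, map_zero]
    rw [Derivation.leibniz, h4.D 4 (by omega)] at h3
    simp [hu, hu', hu'', hv, hv', hz', L_w, R5, pd_four_four_L_Dw, Derivation.leibniz_pow] at h3
    apply eq_zero_of_s_sq_mul (J := J) (c := -6) (by norm_num)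
    linear_combination (norm := algebra) h3
  subst hγ0
  obtain ⟨ε, hε_def⟩ : ∃ ε, ε = J.u 1 * J.pd (.u 2) G := ⟨_, rfl⟩
  -- The two `D^2 w` terms with factor `β_t`, from `R5` and from `L (x w)`, cancel, so `L G` is free
  -- of `u_4`.
  have hε : J.D ε = 0 := by
    rw [hε_def]
    refine D_eq_zero_of_top (m := 0) hG ?_
    rw [hLG]
    simp [hu, hu', hu'', hz', L_w, R5, Derivation.leibniz_pow]
    algebra
  have hε' := D_Dt_eq_zero hε
  have hy := fun k => pd_u_of_D_eq_zero hε k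
  have hy' := fun k => pd_u_of_D_eq_zero hε' k
  obtain ⟨G₁, hG₁_def⟩ : ∃ G₁, G₁ = G - ε * J.a := ⟨_, rfl⟩
  have hG₁ : J.OrdLE 1 G₁ := by
    rw [hG₁_def]
    refine hG.sub_of_eq ((ordLE_of_D_eq_zero hε 2).mul J.ordLE_a) ?_
    rw [Derivation.leibniz, pd_two_a, hy, smul_zero, add_zero, hε_def, smul_eq_mul]
    linear_combination -J.pd (.u 2) G * J.u_s
  have hLG₁ : J.L G₁ = J.L G - (ε * J.L J.a + J.Dt ε * J.a) := by
    rw [hG₁_def, L_sub, L_const_mul hε]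
  rw [hLG, L_a] at hLG₁
  obtain ⟨M, hM_def⟩ : ∃ M, M = J.u 1 * J.pd (.u 1) G₁ + G₁ := ⟨_, rfl⟩
  have hM : J.OrdLE 1 M := hM_def ▸ ((J.ordLE_u (by omega)).mul fun k hk => by
    rw [J.pd_comm, hG₁ k hk, map_zero]).add hG₁
  have h3 := J.pd_L_one hG₁
  rw [hLG₁, ← hM_def] at h3
  -- Coefficient of `u_3^2`: `-3 β_t` from `R5`, `+2 β_t` from `x w` and `+6 ε` from `L a` must add
  -- up to zero.
  have hε0 : ε = (1 / 6 : ℝ) • J.Dt β := by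
    have h4 := congrArg (J.pd (.u 3)) h3
    rw [Derivation.leibniz, hM.D 3 (by omega)] at h4
    simp [hu, hu', hu'', hz', hy, hy', L_w, R5, Derivation.leibniz_pow] at h4
    rw [← sub_eq_zero]
    apply eq_zero_of_s_sq_mul (J := J) (c := 6) (by norm_num)
    linear_combination (norm := algebra) h4
  -- With this `ε` the terms in `w` of the `u_3`-derivative cancel, but `β_t a^2 s / 2` stays,
  -- whereas `s D M` is affine in `u_2`.
  have hβ'0 : J.Dt β = 0 := by
    have h5 := hM.pd_D
    have h4 := congrArg (fun X => J.pd (.u 2) (J.pd (.u 2) X)) h3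
    have h6 : J.pd (.u 2) (J.pd (.u 1) M) = 0 := by rw [J.pd_comm, hM 2 (by omega), map_zero]
    simp [hε0, hu, hu', hu'', hz', L_w, R5, Derivation.leibniz_pow, h5, h6] at h4
    apply eq_zero_of_s_mul (J := J)
    apply eq_zero_of_s_sq_mul (J := J) (c := 1) (by norm_num)
    linear_combination (norm := algebra) h4
  have hε0' : ε = 0 := by rw [hε0, hβ'0, smul_zero]
  subst hε0'
  have hMD : J.D M = (1 / 3 : ℝ) • J.Dt δ := by
    simp [hβ'0, hu, hz'] at h3
    rw [← sub_eq_zero]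
    apply eq_zero_of_s_mul (J := J)
    linear_combination (norm := algebra) (-(1 / 3 : ℝ)) • h3
  -- `M = ∂(u_1 G₁)/∂u_1` equals `δ_t x / 3` plus a function of `t`, hence is free of `u_1`; so `q =
  -- u_1 (G₁ - M)` is free of `u_1` too.
  refine ⟨β, δ, M - (1 / 3 : ℝ) • (J.Dt δ * J.coord .x),
    J.u 1 * (G₁ - (1 / 3 : ℝ) • (J.Dt δ * J.coord .x) -
      (M - (1 / 3 : ℝ) • (J.Dt δ * J.coord .x))), hβ, hβ'0, hδ, ?_, ?_, ?_⟩
  · simp [hMD, hδ']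
  · intro k hk
    rcases Nat.lt_or_ge 1 k with hk' | hk'
    · simp [hG₁ k hk', hM k hk', J.ordLE_u (le_refl 1) k hk']
    · obtain rfl : k = 1 := by omega
      have h4 : J.pd (.u 1) M = 0 := by
        rw [← hM.pd_D, hMD]
        simp [hz']
      simp [h4, pd_u_self]
      rw [hM_def]
      ring
  · rw [hR, hβ'0]
    linear_combination (norm := algebra) -hG₁_def - (G₁ - M) * J.u_s
end JetCalculus

/-! ### Determining equations and the classification. -/

namespace JetCalculus

variable {A : Type*} [CommRing A] [Algebra ℝ A] {J : JetCalculus A}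

lemma OrdLE.pd {n : ℕ} {G : A} (h : J.OrdLE n G) (i : Coord) : J.OrdLE n (J.pd i G) :=
  fun k hk => by rw [J.pd_comm, h k hk, map_zero]

lemma D_of_ordLE_zero {q : A} (h : J.OrdLE 0 q) :
    J.D q = J.pd .x q + J.u 1 * J.pd (.u 0) q := by
  rw [J.D_eq_sum h]; simp

lemma Dt_of_ordLE_zero {q : A} (h : J.OrdLE 0 q) :
    J.Dt q = J.pd .t q + J.u 1 * J.H * J.pd (.u 0) q := by
  classical
  rw [Dt, J.field_eq_sum' (S := {.t, .u 0})]
  · rw [Finset.sum_pair (by simp)]; simp [dtComp]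
  · rintro (_ | _ | k) hk
    · simp at hk
    · simp [dtComp]
    · rw [h k (by simp at hk; omega), mul_zero]

lemma D_mul_s {q : A} (h : J.OrdLE 0 q) :
    J.D (q * J.s) = J.pd .x q * J.s + J.pd (.u 0) q - J.a * (q * J.s) := by
  rw [Derivation.leibniz, D_of_ordLE_zero h, D_s, smul_eq_mul, smul_eq_mul]
  linear_combination J.pd (.u 0) q * J.u_s

lemma Dt_mul_s {q : A} (h : J.OrdLE 0 q) : J.Dt (q * J.s) = J.pd .t q * J.s
    + J.H * J.pd (.u 0) q - q * J.s * (J.a * J.H + J.D J.H) := by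
  rw [Derivation.leibniz, Dt_of_ordLE_zero h, Dt_s, smul_eq_mul, smul_eq_mul]
  linear_combination J.H * J.pd (.u 0) q * J.u_s

/-- Expanding in `a`, `u_1` and `s` with coefficients of order zero allows comparison of
coefficients; the only `a^2` term carries `q_x`. -/
lemma L_mul_s {q : A} (h : J.OrdLE 0 q) : J.L (q * J.s) = J.pd .t q * J.s
    + 2 * J.g0 * J.pd (.u 0) q - q * J.s * J.g1
    - J.u 1 ^ 2 * J.pd (.u 0) (J.pd (.u 0) (J.pd (.u 0) q))
    + J.pd .x q * J.s * J.g0 - (J.pd .x (J.pd .x (J.pd .x q)) * J.s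
      + 3 * J.pd (.u 0) (J.pd .x (J.pd .x q)) - 3 * J.a * J.pd .x (J.pd .x q) * J.s
      + 3 * J.u 1 * J.pd (.u 0) (J.pd (.u 0) (J.pd .x q)) - 3 * J.a * J.pd (.u 0) (J.pd .x q)
      + (3 / 2 : ℝ) • (J.a ^ 2 * J.pd .x q * J.s)) := by
  rw [L, Dt_mul_s h]
  simp only [D_mul_s h, D_mul_s (h.pd .x), D_mul_s ((h.pd .x).pd .x), D_of_ordLE_zero (h.pd (.u 0)),
    D_of_ordLE_zero ((h.pd .x).pd (.u 0)), D_of_ordLE_zero ((h.pd (.u 0)).pd (.u 0)),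
    Derivation.leibniz J.D (q * J.s), Derivation.map_smul, Derivation.leibniz_pow, H,
    map_add, map_sub, nsmul_eq_mul, Nat.cast_ofNat, Nat.add_one_sub_one, pow_one, Derivation.leibniz J.D J.a, Derivation.leibniz J.D (J.u 1), D_u_one, D_a,
    D_g0, smul_eq_mul, J.pd_comm .x (.u 0)]
  algebra

/-- A polynomial in `u_1` with coefficients of order zero vanishes only if its coefficients do. -/
lemma coeff_eq_zero {X₀ X₁ X₂ X₄ X₅ : A} (h₀ : J.OrdLE 0 X₀) (h₁ : J.OrdLE 0 X₁)
    (h₂ : J.OrdLE 0 X₂) (h₄ : J.OrdLE 0 X₄) (h₅ : J.OrdLE 0 X₅)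
    (h : X₀ + X₁ * J.u 1 + X₂ * J.u 1 ^ 2 + X₄ * J.u 1 ^ 4 + X₅ * J.u 1 ^ 5 = 0) :
    X₀ = 0 ∧ X₁ = 0 ∧ X₂ = 0 ∧ X₄ = 0 ∧ X₅ = 0 := by
  have e₀ := h₀ 1 one_pos
  have e₁ := h₁ 1 one_pos
  have e₂ := h₂ 1 one_pos
  have e₄ := h₄ 1 one_pos
  have e₅ := h₅ 1 one_pos
  -- In the abstract algebra coefficients are isolated by differentiating in `u_1` five times and
  -- solving from the top degree down.
  have step : ∀ {X Y : A}, X = Y → J.pd (.u 1) X = J.pd (.u 1) Y := congrArg _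
  have d1 := step h
  simp [e₀, e₁, e₂, e₄, e₅, Derivation.leibniz_pow, pd_u_self] at d1
  have d2 := step d1
  simp [e₁, e₂, e₄, e₅, Derivation.leibniz_pow, pd_u_self] at d2
  have d3 := step d2
  simp [e₂, e₄, e₅, Derivation.leibniz_pow, pd_u_self] at d3
  have d4 := step d3
  simp [e₄, e₅, Derivation.leibniz_pow, pd_u_self] at d4
  have d5 := step d4
  simp [e₄, e₅, pd_u_self] at d5
  have z5 : X₅ = 0 := by linear_combination (norm := algebra) (1 / 120 : ℝ) • d5
  subst z5
  have z4 : X₄ = 0 := by linear_combination (norm := algebra) (1 / 24 : ℝ) • d4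
  subst z4
  have z2 : X₂ = 0 := by linear_combination (norm := algebra) (1 / 2 : ℝ) • d2
  subst z2
  have z1 : X₁ = 0 := by linear_combination (norm := algebra) d1
  subst z1
  exact ⟨by linear_combination h, rfl, rfl, rfl, rfl⟩

lemma exists_const {G : A} (h : J.D G = 0) (ht : J.Dt G = 0) : ∃ c : ℝ, G = algebraMap ℝ A c := by
  have hx := pd_x_of_D_eq_zero h
  have hu := pd_u_of_D_eq_zero h
  refine J.const G ?_
  rintro (_ | _ | k)
  · rwa [Dt_of_ordLE_zero (ordLE_of_D_eq_zero h 0), hu, mul_zero, add_zero] at ht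
  · exact hx
  · exact hu k

/-- A function of `u` alone with vanishing `n`-th derivative is a polynomial. -/
lemma exists_polynomial (n : ℕ) : ∀ {G : A}, (∀ i, i ≠ .u 0 → J.pd i G = 0) →
    (J.pd (.u 0))^[n] G = 0 → ∃ c : ℕ → ℝ, G = ∑ k ∈ Finset.range n, c k • J.u 0 ^ k := by
  induction n with
  | zero => exact fun _ h => ⟨0, h⟩
  | succ n ih =>
    intro G hG h
    obtain ⟨c, hc⟩ := ih (G := J.pd (.u 0) G)
      (fun i hi => by rw [J.pd_comm, hG i hi, map_zero]) h
    obtain ⟨d, hd⟩ := J.const (G - ∑ k ∈ Finset.range n, (c k / (k + 1)) • J.u 0 ^ (k + 1)) (by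
      intro i
      by_cases hi : i = .u 0
      · subst hi
        rw [map_sub, hc, map_sum, sub_eq_zero]
        refine Finset.sum_congr rfl fun k _ => ?_
        rw [Derivation.map_smul, Derivation.leibniz_pow, pd_u_self]
        simp [← Nat.cast_smul_eq_nsmul ℝ, smul_smul]
        congr 1
        field_simp
      · rw [map_sub, hG i hi, map_sum, Finset.sum_eq_zero, sub_zero]
        intro k _
        rw [Derivation.map_smul, Derivation.leibniz_pow, u, J.pd_coord_ne _ _ hi]
        simp)
    -- Termwise integration; `d` is the integration constant.
    refine ⟨fun k => k.casesOn d fun k => c k / (k + 1), ?_⟩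
    rw [Finset.sum_range_succ']
    simp only [pow_zero]
    rw [← Algebra.algebraMap_eq_smul_one]
    exact eq_add_of_sub_eq' hd

variable (J) in
/-- The determining equation of the point symmetries. -/
def DilationEq (b q₀ q₁ q₂ : ℝ) : Prop :=
  2 * J.F 0 * ((2 * q₂) • J.u 0 + algebraMap ℝ A (q₁ + 2 * b)) =
    J.F 1 * (q₂ • J.u 0 ^ 2 + q₁ • J.u 0 + algebraMap ℝ A q₀)

variable (J) in
/-- The characteristic of the point transformations divided by `u_1`. -/
def pointSym (b q₀ q₁ q₂ : ℝ) : A :=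
  (3 * b) • (J.coord .t * J.H) + b • J.coord .x
    + (q₂ • J.u 0 ^ 2 + q₁ • J.u 0 + algebraMap ℝ A q₀) * J.s

lemma ordLE_zero_quadratic (q₀ q₁ q₂ : ℝ) :
    J.OrdLE 0 (q₂ • J.u 0 ^ 2 + q₁ • J.u 0 + algebraMap ℝ A q₀) := fun k hk => by
  simp [Derivation.leibniz_pow, J.ordLE_u (le_refl 0) k hk]

lemma pd_quadratic (q₀ q₁ q₂ : ℝ) :
    J.pd (.u 0) (q₂ • J.u 0 ^ 2 + q₁ • J.u 0 + algebraMap ℝ A q₀) =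
      (2 * q₂) • J.u 0 + algebraMap ℝ A q₁ := by
  simp [Derivation.leibniz_pow, pd_u_self]
  algebra

lemma L_pointSym {b q₀ q₁ q₂ : ℝ} (h : J.DilationEq b q₀ q₁ q₂) :
    J.L (J.pointSym b q₀ q₁ q₂) = 0 := by
  have h1 : J.pd .t (q₂ • J.u 0 ^ 2 + q₁ • J.u 0 + algebraMap ℝ A q₀) = 0 := by
    simp [Derivation.leibniz_pow, u, J.pd_coord_ne]
  have h2 : J.pd .x (q₂ • J.u 0 ^ 2 + q₁ • J.u 0 + algebraMap ℝ A q₀) = 0 := by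
    simp [Derivation.leibniz_pow, u, J.pd_coord_ne]
  have h3 : J.L (J.coord .t) = 1 := by simp [L]
  rw [pointSym, L_add, L_add, L_smul, L_smul, L_mul, L_H, h3, D_t, L_x,
    L_mul_s (ordLE_zero_quadratic q₀ q₁ q₂), h1, h2, pd_quadratic]
  rw [DilationEq, map_add] at h
  simp [pd_u_self, g0, g1, H]
  have e : algebraMap ℝ A (2 * b) = (2 * b) • (1 : A) := Algebra.algebraMap_eq_smul_one _
  rw [e] at h
  linear_combination (norm := algebra) J.s ^ 2 * h

/-- The classification of the symmetries of order at most six. -/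
theorem classification {R : A} (h : J.OrdLE 6 R) (hL : J.L R = 0) :
    ∃ c a₁ a₂ b q₀ q₁ q₂ : ℝ, (c ≠ 0 → J.F 5 = 0) ∧ J.DilationEq b q₀ q₁ q₂ ∧
      R = c • J.R5 + a₁ • J.H + algebraMap ℝ A a₂ + J.pointSym b q₀ q₁ q₂ := by
  obtain ⟨β, δ, ζ, q, hβ, hβt, hδ, hζ, hq, hR⟩ := exists_ordLE_zero (ordLE_five h hL) hL
  have hδ' := D_Dt_eq_zero hδ
  have hδ'' := D_Dt_eq_zero hδ'
  have hζ' := D_Dt_eq_zero hζ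
  have hLR : (4 / 9 : ℝ) • (β * J.g5) + J.Dt δ * (J.w + J.g0) + (1 / 3 : ℝ) •
      (J.Dt (J.Dt δ) * J.coord .x - J.Dt δ * (3 * J.w - J.g0)) + J.Dt ζ + J.L (q * J.s) = 0 := by
    have h1 : J.L ζ = J.Dt ζ := by simp [L, hζ]
    rw [hR] at hL
    simp only [L_add, L_smul, L_const_mul hβ, L_const_mul hδ, L_const_mul hδ', L_R5, L_H, L_x,
      hβt, h1] at hL
    rw [← hL, H]
    algebra
  have hqx : J.pd .x q = 0 := by
    have h2 := congrArg (fun X => J.pd (.u 2) (J.pd (.u 2) X)) hLR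
    have e1 := fun k => pd_u_of_D_eq_zero hβ k
    have e2 := fun k => pd_u_of_D_eq_zero hδ' k
    have e3 := fun k => pd_u_of_D_eq_zero hδ'' k
    have e4 := fun k => pd_u_of_D_eq_zero hζ' k
    rw [L_mul_s hq] at h2
    have hq2 := fun i => (hq.pd i) 2 two_pos
    have hq3 := fun i j => ((hq.pd i).pd j) 2 two_pos
    have hq4 := fun i j k => (((hq.pd i).pd j).pd k) 2 two_pos
    simp [e1, e2, e3, e4, hq 2 two_pos, hq2, hq3, hq4, Derivation.leibniz_pow,
      J.ordLE_u (le_refl 1) 2 one_lt_two] at h2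
    apply eq_zero_of_s_mul (J := J)
    apply eq_zero_of_s_sq_mul (J := J) (c := -3) (by norm_num)
    linear_combination (norm := algebra) h2
  have hq0x : J.pd .x (J.pd (.u 0) q) = 0 := by rw [J.pd_comm, hqx, map_zero]
  rw [L_mul_s hq, hqx] at hLR
  simp only [map_zero] at hLR
  -- `X_k` is the coefficient of `u_1^k` in `u_1^2 L R`; the cubic one is absent because `q_x = 0`.
  obtain ⟨z0, z1, z2, z4, z5⟩ := coeff_eq_zero (J := J)
    (X₀ := (4 / 3 : ℝ) • (J.Dt δ * J.F 0) + (2 : ℝ) • (J.F 0 * J.pd (.u 0) q) - q * J.F 1)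
    (X₁ := J.pd .t q) (X₂ := (1 / 3 : ℝ) • (J.Dt (J.Dt δ) * J.coord .x) + J.Dt ζ)
    (X₄ := -J.pd (.u 0) (J.pd (.u 0) (J.pd (.u 0) q))) (X₅ := (4 / 9 : ℝ) • (β * J.F 5))
    ((((ordLE_of_D_eq_zero hδ' 0).mul (J.ordLE_F 0 0)).smul _).add
      (((J.ordLE_F 0 0).mul (hq.pd _)).smul _) |>.sub (hq.mul (J.ordLE_F 0 1)))
    (hq.pd _)
    ((((ordLE_of_D_eq_zero hδ'' 0).mul (J.ordLE_x 0)).smul _).add (ordLE_of_D_eq_zero hζ' 0))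
    (fun k hk => by rw [map_neg, ((hq.pd (.u 0)).pd (.u 0)).pd (.u 0) k hk, neg_zero])
    (((ordLE_of_D_eq_zero hβ 0).mul (J.ordLE_F 0 5)).smul _)
    (by
      simp only [g0, g1, g5] at hLR
      linear_combination (norm := algebra) J.u 1 ^ 2 * hLR -
        (((4 / 3 : ℝ) • (J.Dt δ * J.F 0) + (2 : ℝ) • (J.F 0 * J.pd (.u 0) q) - q * J.F 1) *
          (J.u 1 * J.s + 1) + J.pd .t q * J.u 1) * J.u_s)
  -- `δ_tt x / 3 + ζ_t = 0`, where `δ_tt` and `ζ_t` do not depend on `x`.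
  have hδtt : J.Dt (J.Dt δ) = 0 := by
    have h2 := congrArg (J.pd .x) z2
    simp [pd_x_of_D_eq_zero hδ'', pd_x_of_D_eq_zero hζ', J.pd_coord_self] at h2
    exact h2
  have hζt : J.Dt ζ = 0 := by simpa [hδtt] using z2
  obtain ⟨c, rfl⟩ := exists_const hβ hβt
  obtain ⟨a₂, rfl⟩ := exists_const hζ hζt
  obtain ⟨b, hb⟩ := exists_const hδ' hδtt
  obtain ⟨a₁, ha₁⟩ := exists_const (J := J) (G := δ - b • J.coord .t) (by simp [hδ])
    (by rw [map_sub, hb, Derivation.map_smul, Dt_t, Algebra.algebraMap_eq_smul_one, sub_self])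
  obtain ⟨p, hp⟩ := exists_polynomial (J := J) 3 (G := q) (by
    rintro (_ | _ | k) hk
    · exact z1
    · exact hqx
    · exact hq k (by by_contra h'; exact hk (by congr 1; omega))) (by simpa using z4)
  have hp' : q = p 2 • J.u 0 ^ 2 + p 1 • J.u 0 + algebraMap ℝ A (p 0) := by
    rw [hp, Algebra.algebraMap_eq_smul_one]
    simp [Finset.sum_range_succ]
    ring
  -- Here `b = δ_t`, whereas `pointSym` is normalized with `3 b` in front of `t H`.
  refine ⟨c, a₁, a₂, b / 3, p 0, p 1, p 2, ?_, ?_, ?_⟩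
  · intro hc
    rw [← Algebra.smul_def, smul_smul, smul_eq_zero_iff_right (by positivity)] at z5
    exact z5
  · rw [hp', pd_quadratic, hb] at z0
    simp only [DilationEq, map_add, Algebra.algebraMap_eq_smul_one] at z0 ⊢
    linear_combination (norm := algebra) z0
  · rw [hR, hb, pointSym, ← hp', eq_add_of_sub_eq ha₁]
    simp only [Algebra.algebraMap_eq_smul_one]
    algebra

end JetCalculus

/-! ### Smooth functions of finitely many jet variables over `Ω`. -/

/-- `trunc` as a linear map. -/
def truncₗ (n : ℕ) : JetInf →ₗ[ℝ] Jet n where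
  toFun := trunc n
  map_add' _ _ := rfl
  map_smul' _ _ := rfl

/-- Extension of a finite jet by zero. -/
def padₗ (n : ℕ) : Jet n →ₗ[ℝ] JetInf where
  toFun y := (y.1, y.2.1, fun k => if h : k ≤ n then y.2.2 ⟨k, Nat.lt_succ_of_le h⟩ else 0)
  map_add' y z := by
    ext k
    · rfl
    · rfl
    · by_cases h : k ≤ n <;> simp [h]
  map_smul' c y := by
    ext k
    · rfl
    · rfl
    · by_cases h : k ≤ n <;> simp [h]

lemma trunc_padₗ (n : ℕ) (y : Jet n) : trunc n (padₗ n y) = y := by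
  ext k
  · rfl
  · rfl
  · exact dif_pos (Nat.le_of_lt_succ k.2)

lemma trunc_padₗ_trunc {m n : ℕ} (h : m ≤ n) (z : JetInf) :
    trunc m (padₗ n (trunc n z)) = trunc m z := by
  ext k
  · rfl
  · rfl
  · exact dif_pos ((Nat.le_of_lt_succ k.2).trans h)

/-- The projection or inclusion between finite jet spaces. -/
def jetMap (n m : ℕ) : Jet n →L[ℝ] Jet m := (truncₗ m ∘ₗ padₗ n).toContinuousLinearMap

lemma jetMap_apply (n m : ℕ) (y : Jet n) : jetMap n m y = trunc m (padₗ n y) := rfl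

lemma jetMap_trunc {m n : ℕ} (h : m ≤ n) (z : JetInf) : jetMap n m (trunc n z) = trunc m z :=
  trunc_padₗ_trunc h z

lemma jetMap_jetMap {k m n : ℕ} (h : k ≤ m) (y : Jet n) :
    jetMap m k (jetMap n m y) = jetMap n k y := trunc_padₗ_trunc h _

variable (Ω : Set (Jet 6))

/-- The infinite jets over `Ω`. -/
def jetsOver : Set JetInf := {z | trunc 6 z ∈ Ω}

/-- The jets of order `n` over `Ω`. -/
def finJetsOver (n : ℕ) : Set (Jet n) := {y | jetMap n 6 y ∈ Ω}

variable {Ω}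

lemma isOpen_finJetsOver (hΩ : IsOpen Ω) (n : ℕ) : IsOpen (finJetsOver Ω n) :=
  hΩ.preimage (jetMap n 6).continuous

lemma trunc_mem_finJetsOver {n : ℕ} (hn : 6 ≤ n) {z : JetInf} (hz : z ∈ jetsOver Ω) :
    trunc n z ∈ finJetsOver Ω n := by
  rw [finJetsOver, Set.mem_ofPred_eq, jetMap_trunc hn]
  exact hz

lemma padₗ_mem_jetsOver {n : ℕ} {y : Jet n} (hy : y ∈ finJetsOver Ω n) :
    padₗ n y ∈ jetsOver Ω := hy

/-- `g` represents `G` on the infinite jets over `Ω`. -/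
structure Represents (Ω : Set (Jet 6)) (n : ℕ) (g : Jet n → ℝ) (G : JetInf → ℝ) : Prop where
  le : 6 ≤ n
  contDiffOn : ContDiffOn ℝ ∞ g (finJetsOver Ω n)
  eq : ∀ z ∈ jetsOver Ω, G z = g (trunc n z)

namespace Represents

variable {n m : ℕ} {g h : Jet n → ℝ} {G H : JetInf → ℝ}

lemma raise (hg : Represents Ω n g G) (hnm : n ≤ m) :
    Represents Ω m (fun y => g (jetMap m n y)) G where
  le := hg.le.trans hnm
  contDiffOn := hg.contDiffOn.comp (jetMap m n).contDiff.contDiffOn fun y hy => by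
    rw [finJetsOver, Set.mem_ofPred_eq, jetMap_jetMap hg.le]; exact hy
  eq z hz := by rw [jetMap_trunc hnm, hg.eq z hz]

lemma congr (hg : Represents Ω n g G) (h : ∀ z ∈ jetsOver Ω, H z = G z) :
    Represents Ω n g H := ⟨hg.le, hg.contDiffOn, fun z hz => (h z hz).trans (hg.eq z hz)⟩

lemma differentiableAt (hΩ : IsOpen Ω) (hg : Represents Ω n g G) {y : Jet n}
    (hy : y ∈ finJetsOver Ω n) : DifferentiableAt ℝ g y :=
  (hg.contDiffOn.contDiffAt ((isOpen_finJetsOver hΩ n).mem_nhds hy)).differentiableAt (by simp)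

/-- Along a line `G` is `g` composed with a line in a finite jet space; membership over `Ω` is an
open condition on the order-six truncation. -/
lemma hasLineDerivAt (hΩ : IsOpen Ω) (hg : Represents Ω n g G) (e : JetInf) {z : JetInf}
    (hz : z ∈ jetsOver Ω) :
    HasLineDerivAt ℝ G (fderiv ℝ g (trunc n z) (trunc n e)) z e := by
  have h1 := (hg.differentiableAt hΩ
    (trunc_mem_finJetsOver hg.le hz)).hasFDerivAt.hasLineDerivAt (trunc n e)
  refine HasDerivAt.congr_of_eventuallyEq h1 ?_
  have hc : Continuous fun t : ℝ => trunc 6 z + t • trunc 6 e := by fun_prop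
  have h0 : ∀ᶠ t : ℝ in nhds 0, trunc 6 z + t • trunc 6 e ∈ Ω :=
    hc.continuousAt.preimage_mem_nhds (hΩ.mem_nhds (by simpa using (show trunc 6 z ∈ Ω from hz)))
  filter_upwards [h0] with t ht
  exact hg.eq (z + t • e) ht

lemma lineDeriv (hΩ : IsOpen Ω) (hg : Represents Ω n g G) (e : JetInf) :
    Represents Ω n (fun y => fderiv ℝ g y (trunc n e)) fun z => lineDeriv ℝ G z e where
  le := hg.le
  contDiffOn := (hg.contDiffOn.fderiv_of_isOpen (isOpen_finJetsOver hΩ n) (by simp)).clm_apply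
    contDiffOn_const
  eq _ hz := (hg.hasLineDerivAt hΩ e hz).lineDeriv

end Represents

/-- The functions on the infinite jets over `Ω` that are smooth functions of finitely many jet
variables. -/
def jetFun (Ω : Set (Jet 6)) : Subalgebra ℝ (jetsOver Ω → ℝ) where
  carrier := {G | ∃ n g, Represents Ω n g (Function.extend Subtype.val G 0)}
  algebraMap_mem' c := ⟨6, fun _ => c, le_rfl, contDiffOn_const, fun z hz => by
    rw [Subtype.val_injective.extend_apply _ _ ⟨z, hz⟩]; rfl⟩
  add_mem' := by
    rintro G H ⟨n, g, hg⟩ ⟨m, h, hh⟩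
    have hg' := hg.raise (le_max_left n m)
    have hh' := hh.raise (le_max_right n m)
    refine ⟨_, _, hg'.le, hg'.contDiffOn.add hh'.contDiffOn, fun z hz => ?_⟩
    have e1 := hg'.eq z hz
    have e2 := hh'.eq z hz
    lift z to jetsOver Ω using hz
    rw [Subtype.val_injective.extend_apply] at e1 e2 ⊢
    rw [Pi.add_apply, e1, e2]
  mul_mem' := by
    rintro G H ⟨n, g, hg⟩ ⟨m, h, hh⟩
    have hg' := hg.raise (le_max_left n m)
    have hh' := hh.raise (le_max_right n m)
    refine ⟨_, _, hg'.le, hg'.contDiffOn.mul hh'.contDiffOn, fun z hz => ?_⟩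
    have e1 := hg'.eq z hz
    have e2 := hh'.eq z hz
    lift z to jetsOver Ω using hz
    rw [Subtype.val_injective.extend_apply] at e1 e2 ⊢
    rw [Pi.mul_apply, e1, e2]

namespace jetFun

/-- Extension by zero. -/
def ext (G : jetFun Ω) : JetInf → ℝ := Function.extend Subtype.val G.1 0

lemma ext_apply (G : jetFun Ω) (z : jetsOver Ω) : (ext G) z = G.1 z :=
  Subtype.val_injective.extend_apply _ _ z

lemma exists_represents (G : jetFun Ω) : ∃ n g, Represents Ω n g (ext G) := G.2

/-- The element represented by a smooth function of finitely many jet variables. -/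
def mk {n : ℕ} {g : Jet n → ℝ} {G : JetInf → ℝ} (h : Represents Ω n g G) : jetFun Ω :=
  ⟨fun z => G z, n, g, h.congr fun z hz => Subtype.val_injective.extend_apply _ _ ⟨z, hz⟩⟩

lemma ext_mk {n : ℕ} {g : Jet n → ℝ} {G : JetInf → ℝ} (h : Represents Ω n g G) {z : JetInf}
    (hz : z ∈ jetsOver Ω) : (ext (mk h)) z = G z := ext_apply (mk h) ⟨z, hz⟩

lemma eq_of_ext {G H : jetFun Ω} (h : ∀ z ∈ jetsOver Ω, (ext G) z = (ext H) z) : G = H := by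
  refine Subtype.ext (funext fun z => ?_)
  rw [← ext_apply, ← ext_apply, h z z.2]

lemma ext_add (G H : jetFun Ω) {z : JetInf} (hz : z ∈ jetsOver Ω) :
    (ext (G + H)) z = (ext G) z + (ext H) z := by
  lift z to jetsOver Ω using hz
  simp [ext_apply]

lemma ext_mul (G H : jetFun Ω) {z : JetInf} (hz : z ∈ jetsOver Ω) :
    (ext (G * H)) z = (ext G) z * (ext H) z := by
  lift z to jetsOver Ω using hz
  simp [ext_apply]

lemma ext_smul (c : ℝ) (G : jetFun Ω) {z : JetInf} (hz : z ∈ jetsOver Ω) :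
    (ext (c • G)) z = c * (ext G) z := by
  lift z to jetsOver Ω using hz
  simp [ext_apply]

lemma ext_algebraMap (c : ℝ) {z : JetInf} (hz : z ∈ jetsOver Ω) :
    (ext (algebraMap ℝ (jetFun Ω) c)) z = c := by
  lift z to jetsOver Ω using hz
  simp [ext_apply]

lemma lineDifferentiableAt (hΩ : IsOpen Ω) (G : jetFun Ω) (e : JetInf) {z : JetInf}
    (hz : z ∈ jetsOver Ω) : LineDifferentiableAt ℝ (ext G) z e := by
  obtain ⟨n, g, hg⟩ := (exists_represents G)
  exact (hg.hasLineDerivAt hΩ e hz).lineDifferentiableAt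

/-- Two functions that agree over `Ω` have the same derivatives over `Ω`. -/
lemma lineDeriv_congr (hΩ : IsOpen Ω) {G H : JetInf → ℝ} (h : ∀ z ∈ jetsOver Ω, G z = H z)
    (e : JetInf) {z : JetInf} (hz : z ∈ jetsOver Ω) : lineDeriv ℝ G z e = lineDeriv ℝ H z e := by
  refine Filter.EventuallyEq.deriv_eq ?_
  have hc : Continuous fun t : ℝ => trunc 6 z + t • trunc 6 e := by fun_prop
  have h0 : ∀ᶠ t : ℝ in nhds 0, trunc 6 z + t • trunc 6 e ∈ Ω :=
    hc.continuousAt.preimage_mem_nhds (hΩ.mem_nhds (by simpa using (show trunc 6 z ∈ Ω from hz)))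
  filter_upwards [h0] with t ht
  exact h (z + t • e) ht

/-- Directional derivative. -/
def dir (hΩ : IsOpen Ω) (e : JetInf) (G : jetFun Ω) : jetFun Ω :=
  ⟨fun z => lineDeriv ℝ (ext G) z e, by
    obtain ⟨n, g, hg⟩ := (exists_represents G)
    exact ⟨n, _, (hg.lineDeriv hΩ e).congr fun z hz =>
      Subtype.val_injective.extend_apply _ _ ⟨z, hz⟩⟩⟩

lemma ext_dir (hΩ : IsOpen Ω) (e : JetInf) (G : jetFun Ω) {z : JetInf} (hz : z ∈ jetsOver Ω) :
    (ext (dir hΩ e G)) z = lineDeriv ℝ (ext G) z e := ext_apply (dir hΩ e G) ⟨z, hz⟩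

/-- Directional derivative as a derivation. -/
def dirDer (hΩ : IsOpen Ω) (e : JetInf) : Derivation ℝ (jetFun Ω) (jetFun Ω) :=
  Derivation.mk'
    { toFun := dir hΩ e
      map_add' := fun G H => eq_of_ext fun z hz => by
        rw [ext_add _ _ hz, ext_dir hΩ e _ hz, ext_dir hΩ e _ hz, ext_dir hΩ e _ hz,
          lineDeriv_congr hΩ (fun z hz => ext_add G H hz) e hz]
        exact ((lineDifferentiableAt hΩ G e hz).hasLineDerivAt.add
          (lineDifferentiableAt hΩ H e hz).hasLineDerivAt).deriv
      map_smul' := fun c G => eq_of_ext fun z hz => by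
        rw [RingHom.id_apply, ext_smul _ _ hz, ext_dir hΩ e _ hz, ext_dir hΩ e _ hz,
          lineDeriv_congr hΩ (fun z hz => ext_smul c G hz) e hz]
        exact ((lineDifferentiableAt hΩ G e hz).hasLineDerivAt.const_mul c).deriv }
    fun G H => eq_of_ext fun z hz => by
      simp only [LinearMap.coe_mk, AddHom.coe_mk, smul_eq_mul]
      rw [ext_add _ _ hz, ext_mul _ _ hz, ext_mul _ _ hz, ext_dir hΩ e _ hz, ext_dir hΩ e _ hz,
        ext_dir hΩ e _ hz, lineDeriv_congr hΩ (fun z hz => ext_mul G H hz) e hz]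
      have h := (HasDerivAt.mul (lineDifferentiableAt hΩ G e hz).hasLineDerivAt
        (lineDifferentiableAt hΩ H e hz).hasLineDerivAt).deriv
      simp only [zero_smul, add_zero] at h
      refine h.trans ?_
      ring

lemma ext_dirDer (hΩ : IsOpen Ω) (e : JetInf) (G : jetFun Ω) {z : JetInf}
    (hz : z ∈ jetsOver Ω) : (ext (dirDer hΩ e G)) z = lineDeriv ℝ (ext G) z e := ext_dir hΩ e G hz

lemma represents_dirDer (hΩ : IsOpen Ω) (e : JetInf) {G : jetFun Ω} {n : ℕ} {g : Jet n → ℝ}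
    (hg : Represents Ω n g (ext G)) :
    Represents Ω n (fun y => fderiv ℝ g y (trunc n e)) (ext (dirDer hΩ e G)) :=
  (hg.lineDeriv hΩ e).congr fun _ hz => ext_dirDer hΩ e G hz

/-- Symmetry of the second derivative of a smooth representative on a finite jet space. -/
lemma dirDer_comm (hΩ : IsOpen Ω) (e e' : JetInf) (G : jetFun Ω) :
    dirDer hΩ e (dirDer hΩ e' G) = dirDer hΩ e' (dirDer hΩ e G) := by
  obtain ⟨n, g, hg⟩ := (exists_represents G)
  refine eq_of_ext fun z hz => ?_
  rw [(represents_dirDer hΩ e (represents_dirDer hΩ e' hg)).eq z hz,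
    (represents_dirDer hΩ e' (represents_dirDer hΩ e hg)).eq z hz]
  have hz' := trunc_mem_finJetsOver hg.le hz
  have hcd := hg.contDiffOn.contDiffAt ((isOpen_finJetsOver hΩ n).mem_nhds hz')
  have hd : DifferentiableAt ℝ (fderiv ℝ g) (trunc n z) :=
    (hcd.fderiv_right (m := ∞) (by simp)).differentiableAt (by simp)
  have key : ∀ v w : Jet n, fderiv ℝ (fun y => fderiv ℝ g y v) (trunc n z) w =
      fderiv ℝ (fderiv ℝ g) (trunc n z) w v := fun v w => by
    rw [fderiv_clm_apply hd (differentiableAt_const v)]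
    simp
  rw [key, key]
  exact (hcd.isSymmSndFDerivAt (by simpa using WithTop.coe_le_coe.2 (le_top : (2 : ℕ∞) ≤ ⊤))) _ _

end jetFun

/-! ### Coordinates, and the model of the abstract calculus. -/

/-- The coordinate directions. -/
def Coord.vec : Coord → JetInf
  | .t => (1, 0, 0)
  | .x => (0, 1, 0)
  | .u k => (0, 0, Pi.single k 1)

/-- The coordinate functions. -/
def Coord.val (z : JetInf) : Coord → ℝ
  | .t => z.1
  | .x => z.2.1
  | .u k => z.2.2 k

lemma partialT_eq (G : JetInf → ℝ) (z : JetInf) : partialT G z = lineDeriv ℝ G z (Coord.vec .t) := by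
  have h := deriv_comp_const_add (fun s => G (s, z.2.1, z.2.2)) z.1 0
  rw [add_zero] at h
  rw [partialT, ← h, lineDeriv]
  congr 1; ext s
  congr 1
  ext <;> simp [Coord.vec]

lemma partialX_eq (G : JetInf → ℝ) (z : JetInf) : partialX G z = lineDeriv ℝ G z (Coord.vec .x) := by
  have h := deriv_comp_const_add (fun s => G (z.1, s, z.2.2)) z.2.1 0
  rw [add_zero] at h
  rw [partialX, ← h, lineDeriv]
  congr 1; ext s
  congr 1
  ext <;> simp [Coord.vec]

lemma partialU_eq (k : ℕ) (G : JetInf → ℝ) (z : JetInf) :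
    partialU k G z = lineDeriv ℝ G z (Coord.vec (.u k)) := by
  have h := deriv_comp_const_add (fun s => G (z.1, z.2.1, Function.update z.2.2 k s)) (z.2.2 k) 0
  rw [add_zero] at h
  rw [partialU, ← h, lineDeriv]
  congr 1; ext s
  congr 1
  ext j
  · simp [Coord.vec]
  · simp [Coord.vec]
  · rcases eq_or_ne j k with rfl | hj
    · simp [Coord.vec]
    · simp [Coord.vec, hj]

open jetFun

variable {Ω : Set (Jet 6)}

lemma represents_coord (i : Coord) : ∃ n g, Represents Ω n g fun z => Coord.val z i := by
  rcases i with _ | _ | k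
  · exact ⟨6, fun y => y.1, le_rfl, contDiff_fst.contDiffOn, fun _ _ => rfl⟩
  · exact ⟨6, fun y => y.2.1, le_rfl, contDiff_snd.fst.contDiffOn, fun _ _ => rfl⟩
  -- `k + 6` is at least `k` and at least the six required by `Represents`.
  · exact ⟨k + 6, fun y => y.2.2 ⟨k, by omega⟩, by omega,
      ((contDiff_apply ℝ ℝ _).comp contDiff_snd.snd).contDiffOn, fun _ _ => rfl⟩

lemma isOpen_uRange (hΩ : IsOpen Ω) : IsOpen (uRange Ω) := by
  have h : IsOpenMap fun z : Jet 6 => z.2.2 0 :=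
    (isOpenMap_eval 0).comp (isOpenMap_snd.comp isOpenMap_snd)
  exact h _ hΩ

lemma contDiffOn_iterate_deriv (hΩ : IsOpen Ω) {f : ℝ → ℝ} (hf : ContDiffOn ℝ ∞ f (uRange Ω))
    (j : ℕ) : ContDiffOn ℝ ∞ (deriv^[j] f) (uRange Ω) := by
  induction j with
  | zero => exact hf
  | succ j ih =>
    rw [Function.iterate_succ_apply']
    exact ih.deriv_of_isOpen (isOpen_uRange hΩ) (by simp)

lemma mem_uRange {z : JetInf} (hz : z ∈ jetsOver Ω) : z.2.2 0 ∈ uRange Ω := ⟨_, hz, rfl⟩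

lemma represents_comp (hΩ : IsOpen Ω) {f : ℝ → ℝ} (hf : ContDiffOn ℝ ∞ f (uRange Ω)) (j : ℕ) :
    Represents Ω 6 (fun y => (deriv^[j] f) (y.2.2 0)) fun z => (deriv^[j] f) (z.2.2 0) where
  le := le_rfl
  contDiffOn := (contDiffOn_iterate_deriv hΩ hf j).comp
    ((contDiff_apply ℝ ℝ _).comp contDiff_snd.snd).contDiffOn
    fun _ hy => mem_uRange (padₗ_mem_jetsOver hy)
  eq _ _ := rfl

lemma represents_inv (hux : ∀ z ∈ Ω, z.2.2 1 ≠ 0) :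
    Represents Ω 6 (fun y => (y.2.2 1)⁻¹) fun z => (z.2.2 1)⁻¹ where
  le := le_rfl
  contDiffOn := ((contDiff_apply ℝ ℝ _).comp contDiff_snd.snd).contDiffOn.inv
    fun y hy => by
      have h := hux _ hy
      rwa [jetMap_apply, trunc_padₗ] at h
  eq _ _ := rfl

lemma trunc_eq_sum_vec (n : ℕ) (y : Jet n) : y = y.1 • trunc n (Coord.vec .t) +
    y.2.1 • trunc n (Coord.vec .x) + ∑ k, y.2.2 k • trunc n (Coord.vec (.u k)) := by
  ext k
  · simp [trunc, Coord.vec, Prod.fst_sum]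
  · simp [trunc, Coord.vec, Prod.fst_sum, Prod.snd_sum]
  · simp [trunc, Coord.vec, Prod.snd_sum, Finset.sum_apply, Pi.single_apply,
      Fin.val_inj]

/-- A function all of whose partial derivatives vanish is constant. -/
lemma jetFun.exists_const (hΩ : IsOpen Ω) (hΩc : IsConnected Ω) {G : jetFun Ω}
    (h : ∀ i, dirDer hΩ (Coord.vec i) G = 0) : ∃ c : ℝ, G = algebraMap ℝ _ c := by
  obtain ⟨n, g, hg⟩ := exists_represents G
  have h0 : ∀ y ∈ finJetsOver Ω n, fderiv ℝ g y = 0 := by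
    intro y hy
    have h1 : ∀ i, fderiv ℝ g y (trunc n (Coord.vec i)) = 0 := fun i => by
      have h2 := (represents_dirDer hΩ (Coord.vec i) hg).eq _ (padₗ_mem_jetsOver hy)
      rw [trunc_padₗ, h i] at h2
      rw [← h2]
      exact ext_apply (0 : jetFun Ω) ⟨_, padₗ_mem_jetsOver hy⟩
    refine ContinuousLinearMap.ext fun v => ?_
    rw [trunc_eq_sum_vec n v, map_add, map_add, map_sum]
    simp [h1]
  -- The fibres over `Ω` are full affine spaces: the segment that sends the jets above order six to
  -- zero stays over the same point, and `g` is constant along it.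
  have hline : ∀ y ∈ finJetsOver Ω n, g y = g (jetMap 6 n (jetMap n 6 y)) := by
    intro y hy
    set v := jetMap 6 n (jetMap n 6 y) - y with hv
    have hmem : ∀ s : ℝ, y + s • v ∈ finJetsOver Ω n := fun s => by
      have : jetMap n 6 v = 0 := by
        rw [hv, map_sub, jetMap_jetMap hg.le, jetMap_apply 6 6, trunc_padₗ, sub_self]
      rw [finJetsOver, Set.mem_ofPred_eq, map_add, map_smul, this, smul_zero, add_zero]
      exact hy
    have hd : ∀ s : ℝ, HasDerivAt (fun s : ℝ => g (y + s • v)) 0 s := fun s => by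
      have h1 := (hg.differentiableAt hΩ (hmem s)).hasFDerivAt
      rw [h0 _ (hmem s)] at h1
      have h2 : HasDerivAt (fun s : ℝ => y + s • v) v s := by
        simpa using ((hasDerivAt_id s).smul_const v).const_add y
      exact (h1.comp_hasDerivAt s h2).congr_deriv (by simp)
    have := is_const_of_deriv_eq_zero (fun s => (hd s).differentiableAt) (fun s => (hd s).deriv) 0 1
    simpa [hv] using this
  have hsec : ∀ y ∈ Ω, jetMap 6 n y ∈ finJetsOver Ω n := fun y hy => by
    rw [finJetsOver, Set.mem_ofPred_eq, jetMap_jetMap hg.le, jetMap_apply, trunc_padₗ]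
    exact hy
  have hconst : ∀ y ∈ Ω, ∀ y' ∈ Ω, g (jetMap 6 n y) = g (jetMap 6 n y') := by
    intro y hy y' hy'
    have hd : ∀ y ∈ Ω, HasFDerivAt (fun y => g (jetMap 6 n y)) (0 : Jet 6 →L[ℝ] ℝ) y :=
      fun y hy => by
        have h1 := (hg.differentiableAt hΩ (hsec y hy)).hasFDerivAt
        rw [h0 _ (hsec y hy)] at h1
        exact (h1.comp y (jetMap 6 n).hasFDerivAt).congr_fderiv (by simp)
    exact hΩ.is_const_of_fderiv_eq_zero hΩc.isPreconnected
      (fun y hy => (hd y hy).differentiableAt.differentiableWithinAt)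
      (fun y hy => (hd y hy).fderiv) hy hy'
  obtain ⟨y₀, hy₀⟩ := hΩc.nonempty
  refine ⟨g (jetMap 6 n y₀), eq_of_ext fun z hz => ?_⟩
  have hz' := trunc_mem_finJetsOver hg.le hz
  rw [hg.eq z hz, hline _ hz', ext_algebraMap _ hz]
  exact hconst _ hz' _ hy₀

lemma lineDeriv_coord (i j : Coord) [Decidable (i = j)] (z : JetInf) :
    lineDeriv ℝ (fun z => Coord.val z j) z (Coord.vec i) = if i = j then 1 else 0 := by
  have h : ∀ t : ℝ, Coord.val (z + t • Coord.vec i) j =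
      Coord.val z j + t * if i = j then 1 else 0 := fun t => by
    rcases i with _ | _ | k <;> rcases j with _ | _ | l <;>
      simp [Coord.val, Coord.vec, Pi.single_apply, eq_comm]
  rw [lineDeriv]
  simp only [h]
  split_ifs <;> simp

/-- The differential calculus of the smooth functions on the infinite jets over `Ω`. -/
def calculus (hΩ : IsOpen Ω) (hΩc : IsConnected Ω) (hux : ∀ z ∈ Ω, z.2.2 1 ≠ 0)
    {f : ℝ → ℝ} (hf : ContDiffOn ℝ ∞ f (uRange Ω)) : JetCalculus (jetFun Ω) where
  pd i := dirDer hΩ (Coord.vec i)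
  pd_comm i j G := dirDer_comm hΩ _ _ G
  pd_finite G := by
    obtain ⟨n, g, hg⟩ := exists_represents G
    refine Set.Finite.subset (s := {.t, .x} ∪ Coord.u '' Set.Iic n) (by
      exact (Set.toFinite _).union ((Set.finite_Iic n).image _)) fun i hi => ?_
    by_contra hin
    rcases i with _ | _ | k
    · simp at hin
    · simp at hin
    · refine hi (eq_of_ext fun z hz => ?_)
      have hk : n < k := by simpa using hin
      have : trunc n (Coord.vec (.u k)) = 0 := by
        ext j
        · rfl
        · rfl
        · have : (j : ℕ) ≠ k := by omega
          simp [trunc, Coord.vec, this]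
      rw [(represents_dirDer hΩ _ hg).eq z hz, this, map_zero]
      exact (ext_apply (0 : jetFun Ω) ⟨z, hz⟩).symm
  coord i := mk (represents_coord i).choose_spec.choose_spec
  pd_coord_self i := by
    classical
    refine eq_of_ext fun z hz => ?_
    rw [ext_dirDer hΩ _ _ hz, lineDeriv_congr hΩ (fun z hz => ext_mk _ hz) _ hz, lineDeriv_coord,
      if_pos rfl]
    exact (ext_apply (1 : jetFun Ω) ⟨z, hz⟩).symm
  pd_coord_ne i j hij := by
    classical
    refine eq_of_ext fun z hz => ?_
    rw [ext_dirDer hΩ _ _ hz, lineDeriv_congr hΩ (fun z hz => ext_mk _ hz) _ hz, lineDeriv_coord,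
      if_neg hij]
    exact (ext_apply (0 : jetFun Ω) ⟨z, hz⟩).symm
  s := mk (represents_inv hux)
  u_one_mul_s := by
    refine eq_of_ext fun z hz => ?_
    rw [ext_mul _ _ hz, ext_mk _ hz, ext_mk _ hz]
    exact (mul_inv_cancel₀ (hux _ hz)).trans (ext_apply (1 : jetFun Ω) ⟨z, hz⟩).symm
  F j := mk (represents_comp hΩ hf j)
  pd_F j := by
    refine eq_of_ext fun z hz => ?_
    rw [ext_dirDer hΩ _ _ hz, lineDeriv_congr hΩ (fun z hz => ext_mk _ hz) _ hz, ext_mk _ hz,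
      lineDeriv, Function.iterate_succ_apply']
    have h := deriv_comp_const_add (deriv^[j] f) (z.2.2 0) 0
    rw [add_zero] at h
    rw [← h]
    simp [Coord.vec]
  pd_F_ne i j hi := by
    refine eq_of_ext fun z hz => ?_
    rw [ext_dirDer hΩ _ _ hz, lineDeriv_congr hΩ (fun z hz => ext_mk _ hz) _ hz, lineDeriv]
    have : ∀ t : ℝ, (z + t • Coord.vec i).2.2 0 = z.2.2 0 := fun t => by
      rcases i with _ | _ | k
      · simp [Coord.vec]
      · simp [Coord.vec]
      · have hk : 0 ≠ k := fun h => hi (by rw [← h])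
        simp [Coord.vec, hk]
    simp only [this, deriv_const]
    exact (ext_apply (0 : jetFun Ω) ⟨z, hz⟩).symm
  const G hG := jetFun.exists_const hΩ hΩc hG

/-! ### The general symmetry, its order and its explicit dependence on `t, x`. -/

namespace JetCalculus

variable {A : Type*} [CommRing A] [Algebra ℝ A] {J : JetCalculus A}

/-- Conjugation by `u_1` turns `L` back into the linearized equation, so `P` is a symmetry exactly
when `L (P / u_1) = 0`. -/
lemma L_s_mul (p : A) : J.L (J.s * p) = J.s * (J.Dt p - J.D (J.D (J.D p)) + 3 * J.a * J.D (J.D p)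
    - (3 / 2 : ℝ) • (J.a ^ 2 * J.D p) + J.g0 * J.D p - J.g1 * p) := by
  simp only [L, Derivation.leibniz, Dt_s, D_s, smul_eq_mul, map_add, map_neg, D_a, H, D_g0,
    Derivation.map_smul, Derivation.leibniz_pow, nsmul_eq_mul, Nat.cast_ofNat, Nat.add_one_sub_one,
    pow_one]
  algebra

lemma L_s_mul_eq_zero_iff {p : A} : J.L (J.s * p) = 0 ↔
    J.Dt p - J.D (J.D (J.D p)) + 3 * J.a * J.D (J.D p)
      - (3 / 2 : ℝ) • (J.a ^ 2 * J.D p) + J.g0 * J.D p - J.g1 * p = 0 := by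
  rw [L_s_mul]
  exact ⟨eq_zero_of_s_mul, fun h => by rw [h, mul_zero]⟩

lemma L_s_mul_u_one_mul (R : A) : J.L (J.s * (J.u 1 * R)) = J.L R := by
  congr 1
  linear_combination R * J.u_s

variable (J) in
/-- The general symmetry. -/
def sol (c a₁ a₂ b q₀ q₁ q₂ : ℝ) : A :=
  c • (J.u 1 * J.R5) + a₁ • (J.u 1 * J.H) + a₂ • J.u 1 + J.u 1 * J.pointSym b q₀ q₁ q₂

lemma isSymmetry_iff {p : A} (hp : J.OrdLE 6 p) : J.L (J.s * p) = 0 ↔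
    ∃ c a₁ a₂ b q₀ q₁ q₂ : ℝ, (c ≠ 0 → J.F 5 = 0) ∧ J.DilationEq b q₀ q₁ q₂ ∧
      p = J.sol c a₁ a₂ b q₀ q₁ q₂ := by
  constructor
  · intro h
    obtain ⟨c, a₁, a₂, b, q₀, q₁, q₂, h1, h2, h3⟩ :=
      classification ((J.ordLE_s.mono (by omega)).mul hp) h
    refine ⟨c, a₁, a₂, b, q₀, q₁, q₂, h1, h2, ?_⟩
    rw [Algebra.algebraMap_eq_smul_one] at h3
    rw [sol]
    linear_combination (norm := algebra) J.u 1 * h3 - p * J.u_s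
  · rintro ⟨c, a₁, a₂, b, q₀, q₁, q₂, h1, h2, rfl⟩
    have e : J.sol c a₁ a₂ b q₀ q₁ q₂ =
        J.u 1 * (c • J.R5 + a₁ • J.H + algebraMap ℝ A a₂ + J.pointSym b q₀ q₁ q₂) := by
      rw [sol, Algebra.algebraMap_eq_smul_one]
      algebra
    have h3 : c • J.g5 = 0 := by
      by_cases hc : c = 0
      · rw [hc, zero_smul]
      · rw [g5, h1 hc, zero_mul, smul_zero]
    rw [e, L_s_mul_u_one_mul, L_add, L_add, L_add, L_smul, L_smul, L_R5, L_H, L_pointSym h2,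
      smul_comm, h3]
    simp [L]

variable (J) in
/-- `p` has differential order exactly `n`. -/
def HasOrd (n : ℕ) (p : A) : Prop := J.OrdLE n p ∧ J.pd (.u n) p ≠ 0

lemma u_one_mul_pointSym (b q₀ q₁ q₂ : ℝ) : J.u 1 * J.pointSym b q₀ q₁ q₂ =
    (3 * b) • (J.coord .t * (J.u 1 * J.H)) + b • (J.coord .x * J.u 1)
      + (q₂ • J.u 0 ^ 2 + q₁ • J.u 0 + algebraMap ℝ A q₀) := by
  rw [pointSym]
  linear_combination (norm := algebra)
    (q₂ • J.u 0 ^ 2 + q₁ • J.u 0 + algebraMap ℝ A q₀) * J.u_s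

lemma ordLE_H : J.OrdLE 3 J.H := J.ordLE_w.add (J.ordLE_g0.mono (by omega))

lemma ordLE_t (n : ℕ) : J.OrdLE n (J.coord .t) := fun k _ => J.pd_u_t k

lemma ordLE_sol₁ (a₂ q₀ q₁ q₂ : ℝ) : J.OrdLE 1 (J.sol 0 0 a₂ 0 q₀ q₁ q₂) := by
  rw [sol, u_one_mul_pointSym]
  simp only [zero_smul, zero_add, mul_zero]
  exact ((J.ordLE_u le_rfl).smul _).add ((ordLE_zero_quadratic _ _ _).mono (by omega))

lemma ordLE_sol₃ (a₁ a₂ b q₀ q₁ q₂ : ℝ) : J.OrdLE 3 (J.sol 0 a₁ a₂ b q₀ q₁ q₂) := by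
  rw [sol, u_one_mul_pointSym]
  simp only [zero_smul, zero_add]
  have hu : J.OrdLE 3 (J.u 1) := J.ordLE_u (by omega)
  have hK := hu.mul ordLE_H
  exact ((hK.smul _).add (hu.smul _)).add (((((ordLE_t 3).mul hK).smul _).add
    (((J.ordLE_x 3).mul hu).smul _)).add ((ordLE_zero_quadratic _ _ _).mono (by omega)))

lemma sol_eq (c a₁ a₂ b q₀ q₁ q₂ : ℝ) : J.sol c a₁ a₂ b q₀ q₁ q₂ =
    c • (J.u 1 * J.R5) + J.sol 0 a₁ a₂ b q₀ q₁ q₂ := by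
  rw [sol, sol]; simp only [zero_smul]; abel

lemma ordLE_sol₅ (c a₁ a₂ b q₀ q₁ q₂ : ℝ) : J.OrdLE 5 (J.sol c a₁ a₂ b q₀ q₁ q₂) := by
  rw [sol_eq]
  exact (((J.ordLE_u (by omega)).mul J.ordLE_R5).smul _).add
    ((ordLE_sol₃ _ _ _ _ _ _).mono (by omega))

lemma pd_one_sol (a₂ q₀ q₁ q₂ : ℝ) :
    J.pd (.u 1) (J.sol 0 0 a₂ 0 q₀ q₁ q₂) = algebraMap ℝ A a₂ := by
  rw [sol, u_one_mul_pointSym]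
  simp only [zero_smul, zero_add, mul_zero]
  rw [map_add, ordLE_zero_quadratic _ _ _ 1 one_pos, Derivation.map_smul, pd_u_self, add_zero,
    Algebra.algebraMap_eq_smul_one]

lemma pd_three_sol (a₁ a₂ b q₀ q₁ q₂ : ℝ) : J.pd (.u 3) (J.sol 0 a₁ a₂ b q₀ q₁ q₂) =
    algebraMap ℝ A a₁ + (3 * b) • J.coord .t := by
  have h : J.pd (.u 3) (J.u 1 * J.H) = 1 := J.pd_dtComp 0
  rw [sol, u_one_mul_pointSym]
  simp only [zero_smul, zero_add, map_add, Derivation.map_smul,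
    Derivation.leibniz _ (J.coord .t) (J.u 1 * J.H), Derivation.leibniz _ (J.coord .x), h,
    pd_u_t, pd_u_x, J.pd_u_ne (show 3 ≠ 1 by omega)]
  simp [Derivation.leibniz_pow, J.pd_u_ne (show 3 ≠ 0 by omega), Algebra.algebraMap_eq_smul_one]

lemma pd_five_sol (c a₁ a₂ b q₀ q₁ q₂ : ℝ) : J.pd (.u 5) (J.sol c a₁ a₂ b q₀ q₁ q₂) =
    algebraMap ℝ A c := by
  rw [sol_eq, map_add, ordLE_sol₃ _ _ _ _ _ _ 5 (by omega), Derivation.map_smul,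
    Derivation.leibniz, pd_five_R5, J.pd_u_ne (by omega), smul_zero, smul_eq_mul, u_s, add_zero,
    add_zero, Algebra.algebraMap_eq_smul_one]

/-- This is the leading coefficient in order three; its `t`-derivative isolates `b`. -/
lemma leading_eq_zero_iff [Nontrivial A] {a b : ℝ} :
    algebraMap ℝ A a + (3 * b) • J.coord .t = 0 ↔ a = 0 ∧ b = 0 := by
  constructor
  · intro h
    have h2 := congrArg (J.pd .t) h
    simp [J.pd_coord_self] at h2
    subst h2
    simpa using h
  · rintro ⟨rfl, rfl⟩
    simp

lemma eq_zero_of_ordLE_four [Nontrivial A] {c a₁ a₂ b q₀ q₁ q₂ : ℝ}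
    (h : J.OrdLE 4 (J.sol c a₁ a₂ b q₀ q₁ q₂)) : c = 0 := by
  simpa [pd_five_sol] using h 5 (by omega)

lemma eq_zero_of_ordLE_two [Nontrivial A] {c a₁ a₂ b q₀ q₁ q₂ : ℝ}
    (h : J.OrdLE 2 (J.sol c a₁ a₂ b q₀ q₁ q₂)) : c = 0 ∧ a₁ = 0 ∧ b = 0 := by
  obtain rfl := eq_zero_of_ordLE_four (h.mono (by omega))
  have := h 3 (by omega)
  rw [pd_three_sol, leading_eq_zero_iff] at this
  exact ⟨rfl, this⟩

lemma not_hasOrd_even [Nontrivial A] {c a₁ a₂ b q₀ q₁ q₂ : ℝ} : ¬ J.HasOrd 2 (J.sol c a₁ a₂ b q₀ q₁ q₂) ∧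
    ¬ J.HasOrd 4 (J.sol c a₁ a₂ b q₀ q₁ q₂) ∧ ¬ J.HasOrd 6 (J.sol c a₁ a₂ b q₀ q₁ q₂) := by
  refine ⟨fun h => ?_, fun h => ?_, fun h => h.2 (ordLE_sol₅ _ _ _ _ _ _ _ 6 (by omega))⟩
  · obtain ⟨rfl, rfl, rfl⟩ := eq_zero_of_ordLE_two h.1
    exact h.2 (ordLE_sol₁ _ _ _ _ 2 (by omega))
  · obtain rfl := eq_zero_of_ordLE_four h.1
    exact h.2 (ordLE_sol₃ _ _ _ _ _ _ 4 (by omega))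

lemma hasOrd_one_iff [Nontrivial A] {c a₁ a₂ b q₀ q₁ q₂ : ℝ} : J.HasOrd 1 (J.sol c a₁ a₂ b q₀ q₁ q₂) ↔
    c = 0 ∧ a₁ = 0 ∧ b = 0 ∧ a₂ ≠ 0 := by
  constructor
  · intro h
    obtain ⟨rfl, rfl, rfl⟩ := eq_zero_of_ordLE_two (h.1.mono (by omega))
    exact ⟨rfl, rfl, rfl, by simpa [pd_one_sol] using h.2⟩
  · rintro ⟨rfl, rfl, rfl, h⟩
    exact ⟨ordLE_sol₁ _ _ _ _, by simpa [pd_one_sol] using h⟩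

lemma hasOrd_three_iff [Nontrivial A] {c a₁ a₂ b q₀ q₁ q₂ : ℝ} : J.HasOrd 3 (J.sol c a₁ a₂ b q₀ q₁ q₂) ↔
    c = 0 ∧ (a₁ ≠ 0 ∨ b ≠ 0) := by
  constructor
  · intro h
    obtain rfl := eq_zero_of_ordLE_four (h.1.mono (by omega))
    have := h.2
    rw [pd_three_sol, ne_eq, leading_eq_zero_iff] at this
    exact ⟨rfl, by tauto⟩
  · rintro ⟨rfl, h⟩
    refine ⟨ordLE_sol₃ _ _ _ _ _ _, ?_⟩
    rw [pd_three_sol, ne_eq, leading_eq_zero_iff]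
    tauto

lemma hasOrd_five_iff [Nontrivial A] {c a₁ a₂ b q₀ q₁ q₂ : ℝ} : J.HasOrd 5 (J.sol c a₁ a₂ b q₀ q₁ q₂) ↔
    c ≠ 0 := by
  refine ⟨fun h => ?_, fun h => ⟨ordLE_sol₅ _ _ _ _ _ _ _, ?_⟩⟩
  · simpa [pd_five_sol] using h.2
  · simpa [pd_five_sol] using h

lemma pd_autonomous {i : Coord} (hi : ∀ k, i ≠ .u k) (c a₁ a₂ : ℝ) :
    J.pd i (c • (J.u 1 * J.R5) + a₁ • (J.u 1 * J.H) + a₂ • J.u 1) = 0 := by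
  have hu : ∀ k, J.pd i (J.u k) = 0 := fun k => J.pd_coord_ne _ _ (hi k)
  have hF : ∀ j, J.pd i (J.F j) = 0 := fun j => J.pd_F_ne _ _ (hi 0)
  have hs : J.pd i J.s = 0 := by rw [derivation_s, hu, mul_zero, neg_zero]
  have ha : J.pd i J.a = 0 := by simp [a, hu, hs]
  have hw : J.pd i J.w = 0 := by simp [w, hu, hs, ha, Derivation.leibniz_pow]
  have hw2 : J.pd i (J.D (J.D J.w)) = 0 := by
    rw [J.pd_D_comm fun k => hi _, J.pd_D_comm fun k => hi _, hw, map_zero, map_zero]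
  have h0 : J.pd i J.g0 = 0 := by simp [g0, hF, hs, Derivation.leibniz_pow]
  have h1 : J.pd i J.g1 = 0 := by simp [g1, hF, hs]
  have h2 : J.pd i J.g2 = 0 := by simp [g2, hF]
  simp [R5, H, hu, ha, hw, hw2, h0, h1, h2, Derivation.leibniz_pow]

/-- In `sol`, explicit `t` and `x` occur only with the factor `b`. -/
lemma ne_zero_of_pd_sol_ne_zero {i : Coord} (hi : ∀ k, i ≠ .u k) {c a₁ a₂ b q₀ q₁ q₂ : ℝ}
    (h : J.pd i (J.sol c a₁ a₂ b q₀ q₁ q₂) ≠ 0) : b ≠ 0 := by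
  rintro rfl
  apply h
  rw [sol, map_add, pd_autonomous hi, u_one_mul_pointSym]
  simp [u, J.pd_coord_ne _ _ (hi 0), Derivation.leibniz_pow]

lemma F_five_eq_zero_iff : J.F 5 = 0 ↔ ∃ c₁ c₂ c₃ c₄ c₅ : ℝ, J.F 0 =
    c₁ • J.u 0 ^ 4 + c₂ • J.u 0 ^ 3 + c₃ • J.u 0 ^ 2 + c₄ • J.u 0 + algebraMap ℝ A c₅ := by
  constructor
  · intro h
    obtain ⟨c, hc⟩ := exists_polynomial (J := J) 5 (G := J.F 0) (fun i hi => J.pd_F_ne i 0 hi)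
      (by simpa [J.pd_F] using h)
    refine ⟨c 4, c 3, c 2, c 1, c 0, ?_⟩
    rw [hc, Algebra.algebraMap_eq_smul_one]
    simp [Finset.sum_range_succ]
    ring
  · rintro ⟨c₁, c₂, c₃, c₄, c₅, h⟩
    have step : ∀ {j : ℕ} {Y : A}, J.F j = Y → J.F (j + 1) = J.pd (.u 0) Y := fun h => by
      rw [← h, J.pd_F]
    have h1 := step h
    simp [Derivation.leibniz_pow, pd_u_self] at h1
    have h2 := step h1
    simp [Derivation.leibniz_pow, pd_u_self] at h2
    have h3 := step h2
    simp [Derivation.leibniz_pow, pd_u_self] at h3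
    have h4 := step h3
    simp [pd_u_self] at h4
    have h5 := step h4
    simpa [Derivation.leibniz_pow, pd_u_self] using h5

end JetCalculus

/-! ### Translation between functions on jets and the algebra. -/

open jetFun

namespace JetCalculus

lemma Dt_eq_sum {A : Type*} [CommRing A] [Algebra ℝ A] (J : JetCalculus A) {n : ℕ} {G : A}
    (h : J.OrdLE n G) : J.Dt G = J.pd .t G +
      ∑ k ∈ Finset.range (n + 1), J.D^[k] (J.u 1 * J.H) * J.pd (.u k) G := by
  classical
  rw [Dt, J.field_eq_sum' (S := insert .t ((Finset.range (n + 1)).image .u))]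
  · rw [Finset.sum_insert (by simp), Finset.sum_image (fun a _ b _ h => by cases h; rfl)]
    simp [dtComp]
  · rintro (_ | _ | j) hj
    · simp at hj
    · simp [dtComp]
    · rw [h j (by simpa using hj), mul_zero]

/-- The expansion in jet coordinates needed to identify `u_1 R5` with `flow5`. -/
lemma D_D_w {A : Type*} [CommRing A] [Algebra ℝ A] (J : JetCalculus A) : J.D (J.D J.w) =
    J.u 5 * J.s - 5 * J.a * (J.u 4 * J.s) - 4 * (J.u 3 * J.s) ^ 2
      + 17 * J.a ^ 2 * (J.u 3 * J.s) - 9 * J.a ^ 4 := by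
  simp only [w, map_sub, map_add, Derivation.leibniz, Derivation.leibniz_pow, D_s, D_a, D_u,
    Derivation.map_smul, map_neg, smul_eq_mul, nsmul_eq_mul, derivation_ofNat, Nat.cast_ofNat,
    Nat.add_one_sub_one, pow_one]
  algebra

end JetCalculus

variable {Ω : Set (Jet 6)}

/-- Evaluation at an infinite jet over `Ω`. -/
def ev (z : jetsOver Ω) : jetFun Ω →ₐ[ℝ] ℝ :=
  (Pi.evalAlgHom ℝ (fun _ : jetsOver Ω => ℝ) z).comp (jetFun Ω).val

lemma ext_eq_ev (G : jetFun Ω) (z : jetsOver Ω) : ext G z = ev z G := ext_apply G z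

lemma eq_iff_ev {G H : jetFun Ω} : G = H ↔ ∀ z, ev z G = ev z H :=
  ⟨fun h z => by rw [h], fun h => Subtype.ext (funext h)⟩

/-- `G` agrees with `p` over `Ω`. -/
def Agrees (G : JetInf → ℝ) (p : jetFun Ω) : Prop := ∀ z : jetsOver Ω, G z = ev z p

section

variable (hΩ : IsOpen Ω) (hΩc : IsConnected Ω) (hux : ∀ z ∈ Ω, z.2.2 1 ≠ 0)
  {f : ℝ → ℝ} (hf : ContDiffOn ℝ ∞ f (uRange Ω))

lemma ev_t (z : jetsOver Ω) : ev z ((calculus hΩ hΩc hux hf).coord .t) = z.1.1 := rfl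

lemma ev_x (z : jetsOver Ω) : ev z ((calculus hΩ hΩc hux hf).coord .x) = z.1.2.1 := rfl

lemma ev_u (k : ℕ) (z : jetsOver Ω) : ev z ((calculus hΩ hΩc hux hf).u k) = z.1.2.2 k := rfl

lemma ev_s (z : jetsOver Ω) : ev z (calculus hΩ hΩc hux hf).s = (z.1.2.2 1)⁻¹ := rfl

lemma ev_F (j : ℕ) (z : jetsOver Ω) :
    ev z ((calculus hΩ hΩc hux hf).F j) = (deriv^[j] f) (z.1.2.2 0) := rfl

variable {G : JetInf → ℝ} {p : jetFun Ω}

lemma Agrees.lineDeriv (h : Agrees G p) (i : Coord) (z : jetsOver Ω) :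
    lineDeriv ℝ G z (Coord.vec i) = ev z ((calculus hΩ hΩc hux hf).pd i p) := by
  rw [lineDeriv_congr hΩ (fun z hz => (h ⟨z, hz⟩).trans (ext_eq_ev p ⟨z, hz⟩).symm) _ z.2]
  rfl

lemma Agrees.partialT (h : Agrees G p) (z : jetsOver Ω) :
    partialT G z = ev z ((calculus hΩ hΩc hux hf).pd .t p) := by
  rw [partialT_eq, h.lineDeriv hΩ hΩc hux hf]

lemma Agrees.partialX (h : Agrees G p) (z : jetsOver Ω) :
    partialX G z = ev z ((calculus hΩ hΩc hux hf).pd .x p) := by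
  rw [partialX_eq, h.lineDeriv hΩ hΩc hux hf]

lemma Agrees.partialU (h : Agrees G p) (k : ℕ) (z : jetsOver Ω) :
    partialU k G z = ev z ((calculus hΩ hΩc hux hf).pd (.u k) p) := by
  rw [partialU_eq, h.lineDeriv hΩ hΩc hux hf]

lemma Agrees.finsum (h : Agrees G p) {n : ℕ} (hn : (calculus hΩ hΩc hux hf).OrdLE n p)
    (c : ℕ → ℝ) (z : jetsOver Ω) : ∑ᶠ k : ℕ, c k * GKN.partialU k G z =
      ∑ k ∈ Finset.range (n + 1), c k * ev z ((calculus hΩ hΩc hux hf).pd (.u k) p) := by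
  simp only [h.partialU hΩ hΩc hux hf]
  refine finsum_eq_sum_of_support_subset _ fun k hk => ?_
  by_contra hkn
  refine hk ?_
  simp only
  rw [hn k (by simpa using hkn), map_zero, mul_zero]

lemma Agrees.totalX (h : Agrees G p) : Agrees (totalX G) ((calculus hΩ hΩc hux hf).D p) := by
  intro z
  obtain ⟨n, hn⟩ := (calculus hΩ hΩc hux hf).exists_ordLE p
  rw [GKN.totalX, h.partialX hΩ hΩc hux hf, h.finsum hΩ hΩc hux hf hn, JetCalculus.D_eq_sum _ hn,
    map_add, map_sum]
  simp only [map_mul, ev_u]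

lemma Agrees.iterate_totalX (h : Agrees G p) (k : ℕ) :
    Agrees (GKN.totalX^[k] G) ((calculus hΩ hΩc hux hf).D^[k] p) := by
  induction k with
  | zero => exact h
  | succ k ih =>
    rw [Function.iterate_succ_apply', Function.iterate_succ_apply']
    exact ih.totalX hΩ hΩc hux hf

lemma agrees_flow3 : Agrees (lift (flow3 f))
    ((calculus hΩ hΩc hux hf).u 1 * (calculus hΩ hΩc hux hf).H) := by
  intro z
  have h1 : z.1.2.2 1 ≠ 0 := hux _ z.2
  simp only [JetCalculus.H, JetCalculus.w, JetCalculus.g0, JetCalculus.a, map_mul, map_add,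
    map_sub, map_smul, map_pow, ev_u, ev_s, ev_F, Function.iterate_zero, id_eq, smul_eq_mul]
  simp only [lift, flow3, trunc, Fin.coe_ofNat_eq_mod, Nat.reduceAdd, Nat.reduceMod]
  field_simp

lemma agrees_flow5 : Agrees (lift (flow5 f))
    ((calculus hΩ hΩc hux hf).u 1 * (calculus hΩ hΩc hux hf).R5) := by
  intro z
  have h1 : z.1.2.2 1 ≠ 0 := hux _ z.2
  simp only [JetCalculus.R5, JetCalculus.D_D_w]
  simp only [JetCalculus.w, JetCalculus.g0, JetCalculus.g1,
    JetCalculus.g2, JetCalculus.a, map_mul, map_add, map_sub, map_smul, map_pow, map_ofNat, ev_u,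
    ev_s, ev_F, Function.iterate_zero, id_eq, smul_eq_mul]
  simp only [lift, flow5, trunc, Fin.coe_ofNat_eq_mod, Nat.reduceAdd, Nat.reduceMod,
    iteratedDeriv_eq_iterate, Function.iterate_succ, Function.iterate_zero, Function.comp_apply,
    id_eq]
  field_simp
  ring

lemma agrees_dilation (b q₀ q₁ q₂ : ℝ) : Agrees (lift (dilation f b q₀ q₁ q₂))
    ((calculus hΩ hΩc hux hf).u 1 * (calculus hΩ hΩc hux hf).pointSym b q₀ q₁ q₂) := by
  intro z
  rw [JetCalculus.u_one_mul_pointSym]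
  simp only [map_add, map_smul, map_mul (ev z) (JetCalculus.coord _ _),
    ← agrees_flow3 hΩ hΩc hux hf z]
  simp only [map_pow, ev_t, ev_x, ev_u, smul_eq_mul, AlgHom.commutes, Algebra.algebraMap_self,
    RingHom.id_apply]
  simp only [lift, dilation, trunc, Fin.coe_ofNat_eq_mod, Nat.reduceAdd, Nat.reduceMod]
  ring

lemma Agrees.totalT (h : Agrees G p) : Agrees (totalT f G) ((calculus hΩ hΩc hux hf).Dt p) := by
  intro z
  obtain ⟨n, hn⟩ := (calculus hΩ hΩc hux hf).exists_ordLE p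
  rw [GKN.totalT, h.partialT hΩ hΩc hux hf,
    h.finsum hΩ hΩc hux hf hn fun k => (GKN.totalX^[k] (lift (flow3 f))) z,
    JetCalculus.Dt_eq_sum _ hn, map_add, map_sum]
  simp only [map_mul, ((agrees_flow3 hΩ hΩc hux hf).iterate_totalX hΩ hΩc hux hf _ z)]

lemma Agrees.isSymmetry_iff {P : Jet 6 → ℝ} (h : Agrees (lift P) p) : IsSymmetry f Ω P ↔
    (calculus hΩ hΩc hux hf).L ((calculus hΩ hΩc hux hf).s * p) = 0 := by
  rw [JetCalculus.L_s_mul_eq_zero_iff, eq_iff_ev, IsSymmetry]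
  have key : ∀ z : jetsOver Ω, GKN.totalT f (lift P) z - (GKN.totalX^[3] (lift P)) z
      + 3 * (z.1.2.2 2 / z.1.2.2 1) * (GKN.totalX^[2] (lift P)) z
      - 3 / 2 * (z.1.2.2 2 ^ 2 / z.1.2.2 1 ^ 2) * GKN.totalX (lift P) z
      + f (z.1.2.2 0) / z.1.2.2 1 ^ 2 * GKN.totalX (lift P) z
      - deriv f (z.1.2.2 0) / z.1.2.2 1 * lift P z = ev z ((calculus hΩ hΩc hux hf).Dt p -
        (calculus hΩ hΩc hux hf).D ((calculus hΩ hΩc hux hf).D ((calculus hΩ hΩc hux hf).D p))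
        + 3 * (calculus hΩ hΩc hux hf).a *
          (calculus hΩ hΩc hux hf).D ((calculus hΩ hΩc hux hf).D p)
        - (3 / 2 : ℝ) • ((calculus hΩ hΩc hux hf).a ^ 2 * (calculus hΩ hΩc hux hf).D p)
        + (calculus hΩ hΩc hux hf).g0 * (calculus hΩ hΩc hux hf).D p
        - (calculus hΩ hΩc hux hf).g1 * p) := by
    intro z
    rw [h.totalT hΩ hΩc hux hf z, h.iterate_totalX hΩ hΩc hux hf 3 z,
      h.iterate_totalX hΩ hΩc hux hf 2 z, h.totalX hΩ hΩc hux hf z, h z]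
    simp only [JetCalculus.g0, JetCalculus.g1, JetCalculus.a, map_mul, map_add, map_sub, map_smul,
      map_pow, ev_u, ev_s, ev_F, smul_eq_mul, Function.iterate_succ, Function.iterate_zero,
      Function.comp_apply, id_eq, map_ofNat]
    ring
  constructor
  · intro H z
    rw [← key z, map_zero]
    exact H z z.2
  · intro H z hz
    have := H ⟨z, hz⟩
    rw [← key ⟨z, hz⟩, map_zero] at this
    exact this

lemma Agrees.hasOrder_iff {P : Jet 6 → ℝ} (h : Agrees (lift P) p) (n : ℕ) :
    HasOrder Ω P n ↔ (calculus hΩ hΩc hux hf).HasOrd n p := by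
  refine and_congr ?_ ?_
  · refine forall_congr' fun k => imp_congr_right fun _ => ?_
    rw [eq_iff_ev]
    refine ⟨fun H z => ?_, fun H z hz => ?_⟩
    · rw [← h.partialU hΩ hΩc hux hf, map_zero]
      exact H z z.2
    · rw [h.partialU hΩ hΩc hux hf k ⟨z, hz⟩, H, map_zero]
  · rw [ne_eq, eq_iff_ev, not_forall]
    refine ⟨fun ⟨z, hz, H⟩ => ⟨⟨z, hz⟩, ?_⟩, fun ⟨z, H⟩ => ⟨z, z.2, ?_⟩⟩
    · rwa [map_zero, ← h.partialU hΩ hΩc hux hf]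
    · rwa [h.partialU hΩ hΩc hux hf, ← map_zero (ev z)]

lemma represents_lift {P : Jet 6 → ℝ} (hP : ContDiffOn ℝ ∞ P Ω) : Represents Ω 6 P (lift P) where
  le := le_rfl
  contDiffOn := hP.mono fun y hy => by
    rwa [finJetsOver, Set.mem_ofPred_eq, jetMap_apply, trunc_padₗ] at hy
  eq _ _ := rfl

lemma Agrees.ordLE {n : ℕ} {g : Jet n → ℝ} (h : Agrees G p) (hg : Represents Ω n g G) :
    (calculus hΩ hΩc hux hf).OrdLE n p := by
  intro k hk
  rw [eq_iff_ev]
  intro z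
  have : trunc n (Coord.vec (.u k)) = 0 := by
    ext j
    · rfl
    · rfl
    · have : (j : ℕ) ≠ k := by omega
      simp [trunc, Coord.vec, this]
  rw [← h.lineDeriv hΩ hΩc hux hf, (hg.hasLineDerivAt hΩ _ z.2).lineDeriv, this, map_zero,
    map_zero]

lemma exists_agrees {P : Jet 6 → ℝ} (hP : ContDiffOn ℝ ∞ P Ω) :
    ∃ p : jetFun Ω, Agrees (lift P) p ∧ (calculus hΩ hΩc hux hf).OrdLE 6 p := by
  have h : Agrees (lift P) (mk (represents_lift hP)) := fun z => rfl
  exact ⟨_, h, h.ordLE hΩ hΩc hux hf (represents_lift hP)⟩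

lemma Agrees.eqOn_iff {P Q : Jet 6 → ℝ} {q : jetFun Ω} (hP : Agrees (lift P) p)
    (hQ : Agrees (lift Q) q) : (∀ z ∈ Ω, P z = Q z) ↔ p = q := by
  rw [eq_iff_ev]
  refine ⟨fun h z => ?_, fun h y hy => ?_⟩
  · rw [← hP, ← hQ]
    exact h _ z.2
  · have hz : padₗ 6 y ∈ jetsOver Ω := by
      rw [jetsOver, Set.mem_ofPred_eq, trunc_padₗ]
      exact hy
    have h1 := h ⟨_, hz⟩
    rw [← hP, ← hQ, lift, lift, trunc_padₗ] at h1
    exact h1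

lemma agrees_sol (c a₁ a₂ b q₀ q₁ q₂ : ℝ) : Agrees (lift fun z => c * flow5 f z + a₁ * flow3 f z
    + a₂ * z.2.2 1 + dilation f b q₀ q₁ q₂ z)
    ((calculus hΩ hΩc hux hf).sol c a₁ a₂ b q₀ q₁ q₂) := by
  intro z
  rw [JetCalculus.sol]
  simp only [map_add, map_smul, ← agrees_flow3 hΩ hΩc hux hf z, ← agrees_flow5 hΩ hΩc hux hf z,
    ← agrees_dilation hΩ hΩc hux hf _ _ _ _ z, ev_u, smul_eq_mul]
  rfl

/-- Every value of `u` on `Ω` is attained at an infinite jet, by padding with zeros; so conditions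
on the interval become identities in the algebra. -/
lemma forall_uRange {φ : ℝ → Prop} :
    (∀ v ∈ uRange Ω, φ v) ↔ ∀ z : jetsOver Ω, φ (z.1.2.2 0) := by
  refine ⟨fun h z => h _ (mem_uRange z.2), ?_⟩
  rintro h _ ⟨y, hy, rfl⟩
  have hz : padₗ 6 y ∈ jetsOver Ω := by
    rw [jetsOver, Set.mem_ofPred_eq, trunc_padₗ]
    exact hy
  exact h ⟨_, hz⟩

lemma dilationODE_iff {b q₀ q₁ q₂ : ℝ} : DilationODE f (uRange Ω) b q₀ q₁ q₂ ↔
    (calculus hΩ hΩc hux hf).DilationEq b q₀ q₁ q₂ := by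
  rw [DilationODE, forall_uRange, JetCalculus.DilationEq, eq_iff_ev]
  refine forall_congr' fun z => ?_
  simp only [map_mul, map_add, map_smul, map_pow, map_ofNat, ev_F, ev_u, AlgHom.commutes,
    Algebra.algebraMap_self, RingHom.id_apply, smul_eq_mul, Function.iterate_succ,
    Function.iterate_zero, Function.comp_apply, id_eq, add_assoc]

lemma isQuarticOn_iff : IsQuarticOn f (uRange Ω) ↔ (calculus hΩ hΩc hux hf).F 5 = 0 := by
  rw [JetCalculus.F_five_eq_zero_iff]
  simp only [IsQuarticOn, forall_uRange, eq_iff_ev]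
  simp only [map_add, map_smul, map_pow, ev_F, ev_u, AlgHom.commutes, Algebra.algebraMap_self,
    RingHom.id_apply, smul_eq_mul, Function.iterate_zero, id_eq]

end

end GKN

end

/-! ### The theorem. -/

theorem mainTheorem3 (Ω : Set (GKN.Jet 6)) (hΩ : IsOpen Ω) (hΩc : IsConnected Ω)
    (hux : ∀ z ∈ Ω, z.2.2 1 ≠ 0)
    (f : ℝ → ℝ) (hf : ContDiffOn ℝ ∞ f (GKN.uRange Ω)) (hf0 : ∃ u ∈ GKN.uRange Ω, f u ≠ 0) :
    -- no symmetries of order 2, 4, 6, and in order 1 only point symmetries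
    ((∀ P : GKN.Jet 6 → ℝ, ContDiffOn ℝ ∞ P Ω → GKN.IsSymmetry f Ω P →
        ¬ GKN.HasOrder Ω P 2 ∧ ¬ GKN.HasOrder Ω P 4 ∧ ¬ GKN.HasOrder Ω P 6) ∧
      (∀ P : GKN.Jet 6 → ℝ, ContDiffOn ℝ ∞ P Ω →
        ((GKN.IsSymmetry f Ω P ∧ GKN.HasOrder Ω P 1) ↔
          ∃ a q₀ q₁ q₂ : ℝ, a ≠ 0 ∧ GKN.DilationODE f (GKN.uRange Ω) 0 q₀ q₁ q₂ ∧
            ∀ z ∈ Ω, P z = a * z.2.2 1 + GKN.dilation f 0 q₀ q₁ q₂ z))) ∧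
    -- order 3: only `u_t`, up to point symmetries
    ((GKN.IsSymmetry f Ω (GKN.flow3 f) ∧ GKN.HasOrder Ω (GKN.flow3 f) 3) ∧
      (∀ P : GKN.Jet 6 → ℝ, ContDiffOn ℝ ∞ P Ω →
        ((GKN.IsSymmetry f Ω P ∧ GKN.HasOrder Ω P 3) ↔
          ∃ a₁ a₂ b q₀ q₁ q₂ : ℝ, (a₁ ≠ 0 ∨ b ≠ 0) ∧
            GKN.DilationODE f (GKN.uRange Ω) b q₀ q₁ q₂ ∧
            ∀ z ∈ Ω, P z = a₁ * GKN.flow3 f z + a₂ * z.2.2 1 + GKN.dilation f b q₀ q₁ q₂ z))) ∧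
    -- order 5: only the fifth-order flow, up to point symmetries, and only for quartic `f`
    ((GKN.IsQuarticOn f (GKN.uRange Ω) →
        GKN.IsSymmetry f Ω (GKN.flow5 f) ∧ GKN.HasOrder Ω (GKN.flow5 f) 5) ∧
      (∀ P : GKN.Jet 6 → ℝ, ContDiffOn ℝ ∞ P Ω →
        ((GKN.IsSymmetry f Ω P ∧ GKN.HasOrder Ω P 5) ↔
          GKN.IsQuarticOn f (GKN.uRange Ω) ∧
          ∃ c a₁ a₂ b q₀ q₁ q₂ : ℝ, c ≠ 0 ∧
            GKN.DilationODE f (GKN.uRange Ω) b q₀ q₁ q₂ ∧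
            ∀ z ∈ Ω, P z = c * GKN.flow5 f z + a₁ * GKN.flow3 f z + a₂ * z.2.2 1
              + GKN.dilation f b q₀ q₁ q₂ z))) ∧
    -- explicit dependence on `t` or `x` comes only from a dilational point symmetry
    (∀ P : GKN.Jet 6 → ℝ, ContDiffOn ℝ ∞ P Ω → GKN.IsSymmetry f Ω P →
      (∃ z : GKN.JetInf, GKN.trunc 6 z ∈ Ω ∧
        (GKN.partialT (GKN.lift P) z ≠ 0 ∨ GKN.partialX (GKN.lift P) z ≠ 0)) →
      ∃ b q₀ q₁ q₂ : ℝ, b ≠ 0 ∧ GKN.DilationODE f (GKN.uRange Ω) b q₀ q₁ q₂ ∧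
        GKN.IsSymmetry f Ω (GKN.dilation f b q₀ q₁ q₂) ∧
        ∀ z : GKN.JetInf, GKN.trunc 6 z ∈ Ω →
          GKN.partialT (GKN.lift fun w => P w - GKN.dilation f b q₀ q₁ q₂ w) z = 0 ∧
          GKN.partialX (GKN.lift fun w => P w - GKN.dilation f b q₀ q₁ q₂ w) z = 0) := by
  set J := GKN.calculus hΩ hΩc hux hf with hJ
  obtain ⟨y₀, hy₀⟩ := hΩc.nonempty
  have hz₀ : GKN.padₗ 6 y₀ ∈ GKN.jetsOver Ω := by
    rw [GKN.jetsOver, Set.mem_ofPred_eq, GKN.trunc_padₗ]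
    exact hy₀
  -- Evaluation at a jet over the nonempty `Ω` maps onto a nontrivial ring; this lets real
  -- coefficients be recovered from their images in the algebra.
  have : Nontrivial (GKN.jetFun Ω) := (GKN.ev ⟨_, hz₀⟩).toRingHom.domain_nontrivial
  have hsym : ∀ P : GKN.Jet 6 → ℝ, ContDiffOn ℝ ∞ P Ω → ∃ p : GKN.jetFun Ω,
      GKN.Agrees (GKN.lift P) p ∧ (GKN.IsSymmetry f Ω P ↔ ∃ c a₁ a₂ b q₀ q₁ q₂ : ℝ,
        (c ≠ 0 → J.F 5 = 0) ∧ J.DilationEq b q₀ q₁ q₂ ∧ p = J.sol c a₁ a₂ b q₀ q₁ q₂) := by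
    intro P hP
    obtain ⟨p, hp, h6⟩ := GKN.exists_agrees hΩ hΩc hux hf hP
    exact ⟨p, hp, by rw [hp.isSymmetry_iff hΩ hΩc hux hf, GKN.JetCalculus.isSymmetry_iff h6]⟩
  have hflow3 := GKN.agrees_flow3 hΩ hΩc hux hf
  have hflow5 := GKN.agrees_flow5 hΩ hΩc hux hf
  have hsol := GKN.agrees_sol hΩ hΩc hux hf
  rw [← hJ] at hflow3 hflow5
  have e3 : J.u 1 * J.H = J.sol 0 1 0 0 0 0 0 := by
    simp [GKN.JetCalculus.sol, GKN.JetCalculus.pointSym]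
  have e5 : J.u 1 * J.R5 = J.sol 1 0 0 0 0 0 0 := by
    simp [GKN.JetCalculus.sol, GKN.JetCalculus.pointSym]
  refine ⟨⟨fun P hP hPs => ?_, fun P hP => ?_⟩, ⟨?_, fun P hP => ?_⟩,
    ⟨fun hq => ?_, fun P hP => ?_⟩, fun P hP hPs hdep => ?_⟩
  · obtain ⟨p, hp, hiff⟩ := hsym P hP
    obtain ⟨c, a₁, a₂, b, q₀, q₁, q₂, -, -, rfl⟩ := hiff.1 hPs
    simp only [hp.hasOrder_iff hΩ hΩc hux hf]
    exact GKN.JetCalculus.not_hasOrd_even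
  · obtain ⟨p, hp, hiff⟩ := hsym P hP
    rw [hiff, hp.hasOrder_iff hΩ hΩc hux hf]
    have hrhs : ∀ a q₀ q₁ q₂ : ℝ, (∀ z ∈ Ω, P z = a * z.2.2 1 + GKN.dilation f 0 q₀ q₁ q₂ z) ↔
        p = J.sol 0 0 a 0 q₀ q₁ q₂ := fun a q₀ q₁ q₂ => by
      rw [← hp.eqOn_iff (hsol 0 0 a 0 q₀ q₁ q₂)]
      simp
    simp only [hrhs, GKN.dilationODE_iff hΩ hΩc hux hf]
    constructor
    · rintro ⟨⟨c, a₁, a₂, b, q₀, q₁, q₂, -, hd, rfl⟩, ho⟩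
      obtain ⟨rfl, rfl, rfl, ha⟩ := GKN.JetCalculus.hasOrd_one_iff.1 ho
      exact ⟨a₂, q₀, q₁, q₂, ha, hd, rfl⟩
    · rintro ⟨a, q₀, q₁, q₂, ha, hd, rfl⟩
      exact ⟨⟨0, 0, a, 0, q₀, q₁, q₂, by simp, hd, rfl⟩,
        GKN.JetCalculus.hasOrd_one_iff.2 ⟨rfl, rfl, rfl, ha⟩⟩
  · rw [hflow3.isSymmetry_iff hΩ hΩc hux hf, hflow3.hasOrder_iff hΩ hΩc hux hf]
    refine ⟨?_, ?_⟩
    · rw [GKN.JetCalculus.L_s_mul_u_one_mul, GKN.JetCalculus.L_H]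
    · rw [e3, GKN.JetCalculus.hasOrd_three_iff]
      simp
  · obtain ⟨p, hp, hiff⟩ := hsym P hP
    rw [hiff, hp.hasOrder_iff hΩ hΩc hux hf]
    have hrhs : ∀ a₁ a₂ b q₀ q₁ q₂ : ℝ, (∀ z ∈ Ω, P z = a₁ * GKN.flow3 f z + a₂ * z.2.2 1
        + GKN.dilation f b q₀ q₁ q₂ z) ↔ p = J.sol 0 a₁ a₂ b q₀ q₁ q₂ :=
      fun a₁ a₂ b q₀ q₁ q₂ => by
        rw [← hp.eqOn_iff (hsol 0 a₁ a₂ b q₀ q₁ q₂)]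
        simp
    simp only [hrhs, GKN.dilationODE_iff hΩ hΩc hux hf]
    constructor
    · rintro ⟨⟨c, a₁, a₂, b, q₀, q₁, q₂, -, hd, rfl⟩, ho⟩
      obtain ⟨rfl, ha⟩ := GKN.JetCalculus.hasOrd_three_iff.1 ho
      exact ⟨a₁, a₂, b, q₀, q₁, q₂, ha, hd, rfl⟩
    · rintro ⟨a₁, a₂, b, q₀, q₁, q₂, ha, hd, rfl⟩
      exact ⟨⟨0, a₁, a₂, b, q₀, q₁, q₂, by simp, hd, rfl⟩,
        GKN.JetCalculus.hasOrd_three_iff.2 ⟨rfl, ha⟩⟩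
  · rw [GKN.isQuarticOn_iff hΩ hΩc hux hf] at hq
    rw [hflow5.isSymmetry_iff hΩ hΩc hux hf, hflow5.hasOrder_iff hΩ hΩc hux hf]
    refine ⟨?_, ?_⟩
    · rw [GKN.JetCalculus.L_s_mul_u_one_mul, GKN.JetCalculus.L_R5, GKN.JetCalculus.g5, hq,
        zero_mul, smul_zero]
    · rw [e5, GKN.JetCalculus.hasOrd_five_iff]
      exact one_ne_zero
  · obtain ⟨p, hp, hiff⟩ := hsym P hP
    rw [hiff, hp.hasOrder_iff hΩ hΩc hux hf]
    have hrhs : ∀ c a₁ a₂ b q₀ q₁ q₂ : ℝ, (∀ z ∈ Ω, P z = c * GKN.flow5 f z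
        + a₁ * GKN.flow3 f z + a₂ * z.2.2 1 + GKN.dilation f b q₀ q₁ q₂ z) ↔
        p = J.sol c a₁ a₂ b q₀ q₁ q₂ :=
      fun c a₁ a₂ b q₀ q₁ q₂ => hp.eqOn_iff (hsol c a₁ a₂ b q₀ q₁ q₂)
    simp only [hrhs, GKN.dilationODE_iff hΩ hΩc hux hf, GKN.isQuarticOn_iff hΩ hΩc hux hf]
    constructor
    · rintro ⟨⟨c, a₁, a₂, b, q₀, q₁, q₂, hF, hd, rfl⟩, ho⟩
      have hc := GKN.JetCalculus.hasOrd_five_iff.1 ho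
      exact ⟨hF hc, c, a₁, a₂, b, q₀, q₁, q₂, hc, hd, rfl⟩
    · rintro ⟨hF, c, a₁, a₂, b, q₀, q₁, q₂, hc, hd, rfl⟩
      exact ⟨⟨c, a₁, a₂, b, q₀, q₁, q₂, fun _ => hF, hd, rfl⟩,
        GKN.JetCalculus.hasOrd_five_iff.2 hc⟩
  · obtain ⟨p, hp, hiff⟩ := hsym P hP
    obtain ⟨c, a₁, a₂, b, q₀, q₁, q₂, -, hd, rfl⟩ := hiff.1 hPs
    have hdil := GKN.agrees_dilation hΩ hΩc hux hf b q₀ q₁ q₂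
    rw [← hJ] at hdil
    have ht : ∀ k, GKN.Coord.t ≠ .u k := by simp
    have hx : ∀ k, GKN.Coord.x ≠ .u k := by simp
    have hb : b ≠ 0 := by
      obtain ⟨z, hz, h | h⟩ := hdep
      · rw [hp.partialT hΩ hΩc hux hf ⟨z, hz⟩] at h
        exact GKN.JetCalculus.ne_zero_of_pd_sol_ne_zero (J := J) ht fun h' => h (by rw [h', map_zero])
      · rw [hp.partialX hΩ hΩc hux hf ⟨z, hz⟩] at h
        exact GKN.JetCalculus.ne_zero_of_pd_sol_ne_zero (J := J) hx fun h' => h (by rw [h', map_zero])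
    -- Removing the point transformation leaves the combination of `u_1 R5`, `u_1 H` and `u_1`, to
    -- which `pd_autonomous` applies.
    have hdiff : GKN.Agrees (GKN.lift fun w => P w - GKN.dilation f b q₀ q₁ q₂ w)
        (c • (J.u 1 * J.R5) + a₁ • (J.u 1 * J.H) + a₂ • J.u 1) := by
      intro z
      have h1 := hp z
      rw [GKN.JetCalculus.sol, map_add, ← hdil z] at h1
      exact sub_eq_of_eq_add h1
    refine ⟨b, q₀, q₁, q₂, hb, (GKN.dilationODE_iff hΩ hΩc hux hf).2 hd, ?_, fun z hz => ?_⟩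
    · rw [hdil.isSymmetry_iff hΩ hΩc hux hf, GKN.JetCalculus.L_s_mul_u_one_mul]
      exact GKN.JetCalculus.L_pointSym hd
    · rw [hdiff.partialT hΩ hΩc hux hf ⟨z, hz⟩, hdiff.partialX hΩ hΩc hux hf ⟨z, hz⟩,
        GKN.JetCalculus.pd_autonomous ht, GKN.JetCalculus.pd_autonomous hx, map_zero]
      exact ⟨rfl, rfl⟩
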